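/- Let $q$ be a prime power, let $r\ge 2$, and put $F=\mathbb F_{q^r}$ and $c=\frac{q^r-1}{q-1}$. Let $Y_r\subseteq\mathbb P^2_F$ be the norm-trace curve with affine equation $x^c=y^{q^{r-1}}+\dots+y^q+y$, let $\pi:C_r\to Y_r$ be its normalization (a bijection), and let $P_\infty=(0:1:0)$ and $P_0=(0:0:1)$. Let $B$ be the set of $F$-rational points of $Y_r$ other than $P_\infty$ and $P_0$. For integers $d,a,b\ge 0$ let $H^0(C_r,\pi^*(\mathcal O_{Y_r}(d)(-aP_\infty-bP_0)))$ be the space of sections of $\pi^*\mathcal O_{Y_r}(d)$ that vanish to order at least $a$ at $\pi^{-1}(P_\infty)$ and to order at least $b$ at $\pi^{-1}(P_0)$, and let $H^0(Y_r,\mathcal O_{Y_r}(d)(-aP_\infty-bP_0))$ be the subspace of those sections that are given by forms of degree $d$ on $Y_r$. Write $h^0$ for dimensions over $F$. Let $\mathcal C(d,a,b)\subseteq F^B$ be the code obtained by evaluating $H^0(C_r,\pi^*(\mathcal O_{Y_r}(d)(-aP_\infty-bP_0)))$, dehomogenized by $z=1$, at the points of $C_r$ above $B$. Let $d,a,b$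 be integers with $0<d<q$, $0\le a,b\le c-1$ and $b>d$. Then $$\dim_F\mathcal C(d,a,b)=h^0\bigl(Y_r,\mathcal O_{Y_r}(d-1)(-aP_\infty)\bigr).$$ Moreover, both for $(d,a,b)$ and for $(d-1,a,0)$ the two spaces of sections on $C_r$ and on $Y_r$ defined above coincide, and division by $y$ defines an isomorphism of $F$-vector spaces $$H^0\bigl(Y_r,\mathcal O_{Y_r}(d)(-aP_\infty-bP_0)\bigr)\longrightarrow H^0\bigl(Y_r,\mathcal O_{Y_r}(d-1)(-aP_\infty)\bigr),$$ whose inverse is multiplication by $y$. -/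

import Mathlib

open Polynomial

namespace NormTrace

/-- The degree `c = (q ^ r - 1) / (q - 1)` of the norm-trace curve (an exact division). -/
def normExp (q r : ℕ) : ℕ := (q ^ r - 1) / (q - 1)

section Curve

variable (F : Type*) [Field F] (q r : ℕ)

/-- The trace polynomial `y ^ (q ^ (r - 1)) + ⋯ + y ^ q + y`. -/
noncomputable def tracePoly : F[X] := ∑ i ∈ Finset.range r, (X : F[X]) ^ q ^ i

/-- The affine equation `x ^ c - (y ^ (q ^ (r - 1)) + ⋯ + y)` of the norm-trace curve, as a
polynomial in `x` with coefficients in `F[y]`. -/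
noncomputable def curvePoly : F[X][X] := X ^ normExp q r - C (tracePoly F q r)

/-- The affine coordinate ring `F[x, y] / (x ^ c - Tr y)`. -/
abbrev CoordRing : Type _ := AdjoinRoot (curvePoly F q r)

theorem normExp_pos [hq : Fact (IsPrimePow q)] [hr : Fact (2 ≤ r)] : 0 < normExp q r := by
  have h2 : 2 ≤ q := hq.out.two_le
  have hr2 : r ≠ 0 := by have := hr.out; omega
  unfold normExp
  refine Nat.div_pos ?_ (by omega)
  have := Nat.le_self_pow hr2 q
  omega

theorem coeff_zero_tracePoly [hq : Fact (IsPrimePow q)] : (tracePoly F q r).coeff 0 = 0 := by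
  have h2 : 2 ≤ q := hq.out.two_le
  unfold tracePoly
  rw [finsetSum_coeff]
  refine Finset.sum_eq_zero fun i _ => ?_
  have : 0 < q ^ i := Nat.pow_pos (by omega)
  rw [coeff_X_pow, if_neg (by omega)]

theorem coeff_one_tracePoly [hq : Fact (IsPrimePow q)] [hr : Fact (2 ≤ r)] :
    (tracePoly F q r).coeff 1 = 1 := by
  have h2 : 2 ≤ q := hq.out.two_le
  have hr2 := hr.out
  unfold tracePoly
  rw [finsetSum_coeff, Finset.sum_eq_single 0]
  · simp
  · intro i _ hi
    have : q ≤ q ^ i := Nat.le_self_pow hi q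
    rw [coeff_X_pow, if_neg (by omega)]
  · intro h
    simp at h
    omega

/-- The curve is irreducible: its equation is Eisenstein at `y`. -/
theorem irreducible_curvePoly [hq : Fact (IsPrimePow q)] [hr : Fact (2 ≤ r)] :
    Irreducible (curvePoly F q r) := by
  have hc := normExp_pos q r
  have hmonic : (curvePoly F q r).Monic := monic_X_pow_sub_C _ hc.ne'
  have hdeg : (curvePoly F q r).natDegree = normExp q r := natDegree_X_pow_sub_C
  have hP : (Ideal.span {(X : F[X])}).IsPrime :=
    (Ideal.span_singleton_prime X_ne_zero).2 prime_X
  refine irreducible_of_eisenstein_criterion hP ?_ ?_ ?_ ?_ hmonic.isPrimitive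
  · rw [hmonic.leadingCoeff]
    exact fun h => hP.ne_top ((Ideal.eq_top_iff_one _).2 h)
  · intro n hn
    rw [degree_eq_natDegree hmonic.ne_zero, hdeg] at hn
    have hn' : n ≠ normExp q r := (Nat.cast_lt.1 hn).ne
    rw [curvePoly, coeff_sub, coeff_X_pow, if_neg hn', zero_sub, neg_mem_iff, coeff_C]
    split_ifs
    · rw [Ideal.mem_span_singleton, X_dvd_iff]
      exact coeff_zero_tracePoly F q r
    · exact zero_mem _
  · rw [← natDegree_pos_iff_degree_pos, hdeg]
    exact hc
  · rw [curvePoly, coeff_sub, coeff_X_pow, if_neg hc.ne, zero_sub, neg_mem_iff, coeff_C_zero,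
      Ideal.span_singleton_pow, Ideal.mem_span_singleton, X_pow_dvd_iff]
    intro h
    have := h 1 (by norm_num)
    rw [coeff_one_tracePoly] at this
    exact one_ne_zero this

instance instIsDomainCoordRing [Fact (IsPrimePow q)] [Fact (2 ≤ r)] :
    IsDomain (CoordRing F q r) :=
  AdjoinRoot.isDomain_of_prime (irreducible_curvePoly F q r).prime

/-- The function field of the norm-trace curve, which is also that of its normalization. -/
def FunField : Type _ := FractionRing (CoordRing F q r)

noncomputable instance instFieldFunField [Fact (IsPrimePow q)] [Fact (2 ≤ r)] :
    Field (FunField F q r) :=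
  inferInstanceAs (Field (FractionRing (CoordRing F q r)))

variable [Fact (IsPrimePow q)] [Fact (2 ≤ r)]

noncomputable instance instAlgebraFunField : Algebra (CoordRing F q r) (FunField F q r) :=
  inferInstanceAs (Algebra (CoordRing F q r) (FractionRing (CoordRing F q r)))

instance instIsFractionRingFunField : IsFractionRing (CoordRing F q r) (FunField F q r) :=
  inferInstanceAs (IsFractionRing (CoordRing F q r) (FractionRing (CoordRing F q r)))

noncomputable instance instAlgebraConstants : Algebra F (FunField F q r) :=
  ((algebraMap (CoordRing F q r) (FunField F q r)).comp
    (algebraMap F (CoordRing F q r))).toAlgebra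

instance instIsScalarTowerFunField : IsScalarTower F (CoordRing F q r) (FunField F q r) :=
  IsScalarTower.of_algebraMap_eq fun _ => rfl

/-- The rational function `x` on the curve. -/
noncomputable def xFun : FunField F q r :=
  algebraMap (CoordRing F q r) (FunField F q r) (AdjoinRoot.root (curvePoly F q r))

/-- The rational function `y` on the curve. -/
noncomputable def yFun : FunField F q r :=
  algebraMap (CoordRing F q r) (FunField F q r) (AdjoinRoot.of (curvePoly F q r) X)

/-- The homogeneous coordinates `(x : y : 1)` of the generic point of the curve. -/
noncomputable def genericPoint : Fin 3 → FunField F q r := ![xFun F q r, yFun F q r, 1]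

/-- A point of the normalization `C_r` of the norm-trace curve: a place of the function field
over the field of constants `F`, given by its local ring. -/
structure Place where
  /-- The local ring of `C_r` at the point. -/
  ring : ValuationSubring (FunField F q r)
  constants_mem : ∀ t : F, algebraMap F (FunField F q r) t ∈ ring
  ne_top : ring ≠ ⊤

variable {F q r}

namespace Place

variable (v : Place F q r)

/-- The stalk at `v` of the line bundle `π^* O(1)`, as a submodule of the function field: the
linear form `ℓ` corresponds to the rational function `ℓ / z`. It is generated by the pull-backs
of the three coordinates. -/
noncomputable def stalkOne : Submodule v.ring (FunField F q r) :=
  Submodule.span v.ring (Set.range (genericPoint F q r))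

/-- The sections of `π^* O(d)` near `v` that vanish at `v` to order at least `n`, that is,
the stalk at `v` of `π^* O(d)` multiplied by the `n`-th power of the maximal ideal. -/
noncomputable def vanishing (d n : ℕ) : Submodule v.ring (FunField F q r) :=
  (IsLocalRing.maximalIdeal v.ring ^ n) • (v.stalkOne ^ d)

/-- The normalization map sends `v` to the point with homogeneous coordinates `P`: the
linear forms `P i * X j - P j * X i` that vanish at this point pull back to sections
of `π^* O(1)` that vanish at `v`. -/
def LiesOver (P : Fin 3 → F) : Prop :=
  ∀ i j : Fin 3, P i • genericPoint F q r j - P j • genericPoint F q r i ∈ v.vanishing 1 1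

theorem smul_mem_vanishing {d n : ℕ} {f : FunField F q r} (hf : f ∈ v.vanishing d n) (t : F) :
    t • f ∈ v.vanishing d n := by
  have h := (v.vanishing d n).smul_mem (⟨_, v.constants_mem t⟩ : v.ring) hf
  rwa [Algebra.smul_def]

/-- The rational function `f` is regular at `v` with value `t`. -/
def HasValue (f : FunField F q r) (t : F) : Prop :=
  f - algebraMap F (FunField F q r) t ∈ v.ring.nonunits

end Place

variable (F q r)

/-- The space `H⁰(C_r, π^* O(d)(-a P_∞ - b P₀))`, where `P_∞ = (0 : 1 : 0)` and
`P₀ = (0 : 0 : 1)`. The section `f * z ^ d` is represented by the rational function `f`. -/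
noncomputable def sectionsNorm (d a b : ℕ) : Submodule F (FunField F q r) where
  carrier := {f | ∀ v : Place F q r, f ∈ v.vanishing d 0 ∧
    (v.LiesOver ![0, 1, 0] → f ∈ v.vanishing d a) ∧
    (v.LiesOver ![0, 0, 1] → f ∈ v.vanishing d b)}
  add_mem' hf hg v := ⟨add_mem (hf v).1 (hg v).1,
    fun h => add_mem ((hf v).2.1 h) ((hg v).2.1 h),
    fun h => add_mem ((hf v).2.2 h) ((hg v).2.2 h)⟩
  zero_mem' _ := ⟨zero_mem _, fun _ => zero_mem _, fun _ => zero_mem _⟩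
  smul_mem' t _ hf v := ⟨v.smul_mem_vanishing (hf v).1 t,
    fun h => v.smul_mem_vanishing ((hf v).2.1 h) t,
    fun h => v.smul_mem_vanishing ((hf v).2.2 h) t⟩

/-- The space `H⁰(Y_r, O(d))` of forms of degree `d` on the plane curve `Y_r`. The form
`x ^ i * y ^ j * z ^ (d - i - j)` is represented by the rational function `x ^ i * y ^ j`. -/
noncomputable def forms (d : ℕ) : Submodule F (FunField F q r) :=
  Submodule.span F {f | ∃ i j : ℕ, i + j ≤ d ∧ f = xFun F q r ^ i * yFun F q r ^ j}

/-- The space `H⁰(Y_r, O(d)(-a P_∞ - b P₀))`: the forms of degree `d` on `Y_r` that vanish to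
order at least `a` at `P_∞` and to order at least `b` at `P₀`, where orders are measured on the
normalization. -/
noncomputable def sectionsCurve (d a b : ℕ) : Submodule F (FunField F q r) :=
  forms F q r d ⊓ sectionsNorm F q r d a b

/-- The rational points of `Y_r` other than `P_∞`, its only point at infinity, and `P₀`. -/
abbrev EvalPoint : Type _ :=
  {P : F × F // P.1 ^ normExp q r = ∑ i ∈ Finset.range r, P.2 ^ q ^ i ∧ P ≠ (0, 0)}

/-- The code `C(d, a, b)`: the vectors of values of the sections in
`H⁰(C_r, π^* O(d)(-a P_∞ - b P₀))`, dehomogenized by `z = 1`, at the rational points of `Y_r`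
other than `P_∞` and `P₀` (more precisely, at the points of `C_r` above them). -/
noncomputable def code (d a b : ℕ) : Submodule F (EvalPoint F q r → F) where
  carrier := {w | ∃ f ∈ sectionsNorm F q r d a b, ∀ (P : EvalPoint F q r) (v : Place F q r),
    v.LiesOver ![P.1.1, P.1.2, 1] → v.HasValue f (w P)}
  add_mem' := by
    rintro w w' ⟨f, hf, hw⟩ ⟨g, hg, hw'⟩
    refine ⟨f + g, add_mem hf hg, fun P v hv => ?_⟩
    have h1 := (ValuationSubring.mem_nonunits_iff _).1 (hw P v hv)
    have h2 := (ValuationSubring.mem_nonunits_iff _).1 (hw' P v hv)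
    refine (ValuationSubring.mem_nonunits_iff _).2 ?_
    rw [Pi.add_apply, map_add, add_sub_add_comm]
    exact (v.ring.valuation.map_add _ _).trans_lt (max_lt h1 h2)
  zero_mem' := ⟨0, zero_mem _, fun _ _ _ => (ValuationSubring.mem_nonunits_iff _).2 (by simp)⟩
  smul_mem' := by
    rintro t w ⟨f, hf, hw⟩
    refine ⟨t • f, Submodule.smul_mem _ t hf, fun P v hv => ?_⟩
    have h1 := (ValuationSubring.mem_nonunits_iff _).1 (hw P v hv)
    have h2 := (v.ring.valuation_le_one_iff _).2 (v.constants_mem t)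
    refine (ValuationSubring.mem_nonunits_iff _).2 ?_
    rw [Pi.smul_apply, smul_eq_mul, map_mul, Algebra.smul_def, ← mul_sub, map_mul]
    exact (mul_le_of_le_one_left' h2).trans_lt h1

end Curve

end NormTrace

namespace NormTrace

/-! ### Coordinates on the function field over `F(y)`, and the twist `x ↦ ζ x`. -/

section FunctionField

variable (F : Type*) [Field F] (q r : ℕ) [Fact (IsPrimePow q)] [Fact (2 ≤ r)]

/-! Three facts carry the theorem.

For `d < q`, sections on the normalization are forms. Sections of `π^* O(d)` lie in
`regularFunctions`, a space described by valuation rings and stable under `x ↦ ζ x`, where `ζ ∈ F`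
is a primitive `c`-th root of unity (`c` divides `q ^ r - 1`). Writing a function as a sum of terms
`(a i / s)(y) * x ^ i` with `i < c` splits it into eigenvectors with distinct eigenvalues, so each
term is itself in the space. The `c`-th power of a term is a rational function of `y`, as `x ^ c =
Tr y`. Integrality and squarefreeness of `Tr` make the coefficient a polynomial, and the pole order
where `y` is infinite, with `d < q`, bounds the total degree by `d` (`monomial_mem_forms`,
`regularFunctions_le_forms`).

Vanishing to order `b > d` at `P₀` forces divisibility by `y`. There `x` is a uniformizer and `y` is
`x ^ c` times a unit. Write a form of degree `d` as `h(x) + y g`. The second summand vanishes to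
order at least `c ≥ b`, so `h(x)` vanishes to order at least `b > deg h`, whence `h = 0`. At `P_∞`
the coordinate `y` generates the stalk of `π^* O(1)`, so multiplying by `y` keeps the condition
given by `a` (`exists_eq_mul_yFun_of_mem_sectionsCurve`, `divYEquiv`).

Evaluation is injective on forms of degree `d < q`. Each line `x = s` with `s ≠ 0` meets the curve
in at least `q` rational points, since norms lie in the image of the trace. The form therefore
vanishes identically on these lines, and there are more than `d` of them
(`eq_zero_of_evalMap_eq_zero`, `finrank_code`). -/

theorem algebraMap_of (p : F[X]) :
    algebraMap (CoordRing F q r) (FunField F q r) (AdjoinRoot.of (curvePoly F q r) p) =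
      aeval (yFun F q r) p := by
  have : ((algebraMap (CoordRing F q r) (FunField F q r)).comp
      (AdjoinRoot.of (curvePoly F q r))) = (aeval (R := F) (yFun F q r)).toRingHom := by
    refine Polynomial.ringHom_ext (fun a => ?_) ?_
    · simp only [RingHom.comp_apply, AlgHom.toRingHom_eq_coe, RingHom.coe_coe, aeval_C]
      rfl
    · simp [yFun]
  exact congrArg (fun f => f p) this

theorem aeval_yFun_injective : Function.Injective (aeval (R := F) (yFun F q r)) := by
  intro p p' h
  rw [← algebraMap_of, ← algebraMap_of] at h
  refine AdjoinRoot.of.injective_of_degree_ne_zero ?_ (IsFractionRing.injective _ _ h)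
  rw [degree_eq_natDegree (irreducible_curvePoly F q r).ne_zero, curvePoly, natDegree_X_pow_sub_C]
  exact_mod_cast (normExp_pos q r).ne'

theorem eval₂_curvePoly {S : Type*} [CommRing S] (f : F[X] →+* S) (s : S) :
    (curvePoly F q r).eval₂ f s = s ^ normExp q r - f (tracePoly F q r) := by
  rw [curvePoly, eval₂_sub, eval₂_X_pow, eval₂_C]

theorem root_pow_normExp : AdjoinRoot.root (curvePoly F q r) ^ normExp q r =
    AdjoinRoot.of (curvePoly F q r) (tracePoly F q r) := by
  rw [← sub_eq_zero, ← eval₂_curvePoly, AdjoinRoot.eval₂_root]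

theorem xFun_pow_normExp : xFun F q r ^ normExp q r = aeval (yFun F q r) (tracePoly F q r) := by
  rw [← algebraMap_of, xFun, ← map_pow, root_pow_normExp]

theorem exists_coordinates (α : CoordRing F q r) : ∃ a : ℕ → F[X],
    algebraMap (CoordRing F q r) (FunField F q r) α =
      ∑ i ∈ Finset.range (normExp q r), aeval (yFun F q r) (a i) * xFun F q r ^ i := by
  obtain ⟨p, rfl⟩ := AdjoinRoot.mk_surjective α
  have hmonic : (curvePoly F q r).Monic := monic_X_pow_sub_C _ (normExp_pos q r).ne'
  have hdeg : (curvePoly F q r).natDegree = normExp q r := natDegree_X_pow_sub_C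
  have h1 : AdjoinRoot.mk (curvePoly F q r) p =
      AdjoinRoot.mk (curvePoly F q r) (p %ₘ curvePoly F q r) := by
    rw [AdjoinRoot.mk_eq_mk]
    exact ⟨p /ₘ curvePoly F q r, by rw [sub_eq_iff_eq_add, add_comm, modByMonic_add_div]⟩
  refine ⟨fun i => (p %ₘ curvePoly F q r).coeff i, ?_⟩
  have hlt : (p %ₘ curvePoly F q r).natDegree < normExp q r := by
    rw [← hdeg]
    refine natDegree_modByMonic_lt _ hmonic fun h => ?_
    rw [h, natDegree_one] at hdeg
    exact (normExp_pos q r).ne hdeg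
  rw [h1]
  conv_lhs => rw [as_sum_range' _ _ hlt]
  simp only [map_sum, ← C_mul_X_pow_eq_monomial, map_mul, map_pow, AdjoinRoot.mk_C, AdjoinRoot.mk_X,
    algebraMap_of]
  rfl

/-- The coordinate ring is finite, hence algebraic, over `F[y]`. This is what clears denominators
down to polynomials in `y`. -/
theorem exists_dvd_aeval_yFun (α : CoordRing F q r) (hα : α ≠ 0) : ∃ (s : F[X]) (β : CoordRing F q r),
    s ≠ 0 ∧ AdjoinRoot.of (curvePoly F q r) s = α * β := by
  have hmonic : (curvePoly F q r).Monic := monic_X_pow_sub_C _ (normExp_pos q r).ne'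
  have : Module.Finite F[X] (CoordRing F q r) := hmonic.finite_adjoinRoot
  have hi : IsIntegral F[X] α := IsIntegral.of_finite _ _
  obtain ⟨s, hs, β, h⟩ := hi.isAlgebraic.exists_nonzero_dvd (mem_nonZeroDivisors_of_ne_zero hα)
  exact ⟨s, β, hs, h⟩

theorem exists_coordinates_fraction (f : FunField F q r) : ∃ (s : F[X]) (a : ℕ → F[X]), s ≠ 0 ∧
    f = ∑ i ∈ Finset.range (normExp q r),
      aeval (yFun F q r) (a i) / aeval (yFun F q r) s * xFun F q r ^ i := by
  obtain ⟨α, β, hβ, rfl⟩ := IsFractionRing.div_surjective (A := CoordRing F q r) f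
  obtain ⟨s, γ, hs, h⟩ := exists_dvd_aeval_yFun F q r β (nonZeroDivisors.ne_zero hβ)
  obtain ⟨a, ha⟩ := exists_coordinates F q r (α * γ)
  have hs' : aeval (yFun F q r) s ≠ 0 := by
    rw [Ne, map_eq_zero_iff _ (aeval_yFun_injective F q r)]
    exact hs
  have hβ' : algebraMap (CoordRing F q r) (FunField F q r) β ≠ 0 := by
    rw [Ne, map_eq_zero_iff _ (IsFractionRing.injective _ _)]
    exact nonZeroDivisors.ne_zero hβ
  refine ⟨s, a, hs, ?_⟩
  simp_rw [div_mul_eq_mul_div]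
  rw [← Finset.sum_div, ← ha, div_eq_div_iff hβ' hs', ← algebraMap_of, h]
  simp only [map_mul]
  ring

/-- The endomorphism `x ↦ ζ x`, `y ↦ y` of the coordinate ring, for `ζ ^ c = 1`. -/
noncomputable def twist (ζ : F) (hζ : ζ ^ normExp q r = 1) : CoordRing F q r →+* CoordRing F q r :=
  AdjoinRoot.lift (AdjoinRoot.of (curvePoly F q r))
    (AdjoinRoot.of (curvePoly F q r) (C ζ) * AdjoinRoot.root (curvePoly F q r)) (by
    rw [eval₂_curvePoly, mul_pow, ← map_pow, ← map_pow, hζ, map_one, map_one, one_mul, sub_eq_zero,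
      root_pow_normExp])

/-- The twist by `ζ⁻¹` is a left inverse. -/
theorem twist_injective (ζ : F) (hζ : ζ ^ normExp q r = 1) :
    Function.Injective (twist F q r ζ hζ) := by
  have hζ0 : ζ ≠ 0 := by
    rintro rfl
    rw [zero_pow (normExp_pos q r).ne'] at hζ
    exact zero_ne_one hζ
  have h : (twist F q r ζ⁻¹ (by rw [inv_pow, hζ, inv_one])).comp (twist F q r ζ hζ) =
      RingHom.id _ := by
    refine AdjoinRoot.ringHom_ext ?_ ?_
    · ext <;> simp [twist]
    · simp only [twist, RingHom.comp_apply, AdjoinRoot.lift_root, map_mul, AdjoinRoot.lift_of,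
        RingHom.id_apply]
      rw [← mul_assoc, ← map_mul, ← map_mul, mul_inv_cancel₀ hζ0]
      simp
  exact Function.LeftInverse.injective (g := twist F q r ζ⁻¹ (by rw [inv_pow, hζ, inv_one]))
    fun x => congrArg (fun f => f x) h

theorem exists_twist (ζ : F) (hζ : ζ ^ normExp q r = 1) : ∃ σ : FunField F q r →ₐ[F] FunField F q r,
    σ (xFun F q r) = ζ • xFun F q r ∧ σ (yFun F q r) = yFun F q r := by
  have hinj : Function.Injective
      ((algebraMap (CoordRing F q r) (FunField F q r)).comp (twist F q r ζ hζ)) :=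
    (IsFractionRing.injective _ _).comp (twist_injective F q r ζ hζ)
  refine ⟨{ IsFractionRing.lift hinj with commutes' := fun t => ?_ }, ?_, ?_⟩
  · change IsFractionRing.lift hinj (algebraMap (CoordRing F q r) (FunField F q r)
      (AdjoinRoot.of (curvePoly F q r) (C t))) = _
    rw [IsFractionRing.lift_algebraMap]
    simp only [RingHom.comp_apply, twist, AdjoinRoot.lift_of]
    rfl
  · change IsFractionRing.lift hinj (xFun F q r) = _
    rw [xFun, IsFractionRing.lift_algebraMap]
    simp only [RingHom.comp_apply, twist, AdjoinRoot.lift_root, map_mul, Algebra.smul_def]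
    rfl
  · change IsFractionRing.lift hinj (yFun F q r) = _
    rw [yFun, IsFractionRing.lift_algebraMap]
    simp only [RingHom.comp_apply, twist, AdjoinRoot.lift_of]

end FunctionField

/-! ### Eigenvectors, roots of unity and existence of valuation rings. -/

/-- The components of a vector along eigenspaces for distinct eigenvalues lie in every invariant
subspace that contains the vector. -/
theorem mem_of_sum_eigenvectors_mem {F V ι : Type*} [Field F] [AddCommGroup V] [Module F V]
    (σ : V →ₗ[F] V) (S : Submodule F V) (hS : ∀ v ∈ S, σ v ∈ S) (s : Finset ι)
    (μ : ι → F) (hμ : Set.InjOn μ s) (w : ι → V) (hw : ∀ i ∈ s, σ (w i) = μ i • w i)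
    (h : ∑ i ∈ s, w i ∈ S) {i : ι} (hi : i ∈ s) : w i ∈ S := by
  classical
  have hp : ∀ p : F[X], ∀ v ∈ S, aeval σ p v ∈ S := by
    intro p v hv
    induction p using Polynomial.induction_on' with
    | add p p' h1 h2 => rw [map_add]; exact add_mem h1 h2
    | monomial n t =>
      rw [aeval_monomial]
      refine S.smul_mem t ?_
      induction n with
      | zero => simpa
      | succ n ih => rw [pow_succ']; exact hS _ ih
  have he : ∀ p : F[X], ∀ j ∈ s, aeval σ p (w j) = p.eval (μ j) • w j := by
    intro p j hj
    induction p using Polynomial.induction_on' with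
    | add p p' h1 h2 => rw [map_add, LinearMap.add_apply, h1, h2, eval_add, add_smul]
    | monomial n t =>
      have : (σ ^ n) (w j) = μ j ^ n • w j := by
        induction n with
        | zero => simp
        | succ n ih =>
          rw [pow_succ', Module.End.mul_apply, ih, map_smul, hw j hj, smul_smul, pow_succ]
      rw [aeval_monomial, eval_monomial, mul_smul, ← this]
      rfl
  -- The Lagrange basis polynomial is 1 at `μ i` and 0 at the other eigenvalues, so its value at `σ`
  -- projects the sum onto `w i`.
  have := hp (Lagrange.basis s μ i) _ h
  rw [map_sum, Finset.sum_eq_single_of_mem i hi, he _ i hi, Lagrange.eval_basis_self hμ hi,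
    one_smul] at this
  · exact this
  · intro j hj hji
    rw [he _ j hj, Lagrange.eval_basis_of_ne hji.symm hj, zero_smul]

theorem normExp_mul (q r : ℕ) : (q - 1) * normExp q r = q ^ r - 1 :=
  Nat.mul_div_cancel' (by simpa using Nat.sub_dvd_pow_sub_pow q 1 r)

theorem exists_isPrimitiveRoot_normExp {F : Type*} [Field F] [Finite F] (q r : ℕ) (hq : 2 ≤ q)
    (hr : r ≠ 0) (hF : Nat.card F = q ^ r) : ∃ ζ : F, IsPrimitiveRoot ζ (normExp q r) := by
  obtain ⟨g, hg⟩ := IsCyclic.exists_ofOrder_eq_natCard (α := Fˣ)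
  have hcard : Nat.card Fˣ = (q - 1) * normExp q r := by
    rw [normExp_mul q r, ← hF, Nat.card_units]
  have h0 : 0 < q ^ r - 1 := by
    have := Nat.le_self_pow hr q
    omega
  have := IsPrimitiveRoot.orderOf g
  rw [hg, hcard] at this
  -- The root is `g ^ (q - 1)`, for a generator `g` of the cyclic group of units.
  have h2 := this.pow (by rw [normExp_mul q r]; exact h0) rfl
  exact ⟨_, h2.map_of_injective (f := Units.coeHom F) Units.val_injective⟩

theorem exists_valuationSubring_of_injective {R K : Type*} [CommRing R] [Field K] (f : R →+* K)
    (hf : Function.Injective f) (I : Ideal R) (hI : I ≠ ⊤) :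
    ∃ V : ValuationSubring K, (∀ a, f a ∈ V) ∧ ∀ a ∈ I, f a ∈ V.nonunits := by
  let e : R ≃+* f.range := RingEquiv.ofBijective f.rangeRestrict
    ⟨fun a b h => hf (congrArg Subtype.val h), f.rangeRestrict_surjective⟩
  obtain ⟨V, h1, h2⟩ := Ideal.image_subset_nonunits_valuationSubring (I.comap e.symm.toRingHom)
    (Ideal.comap_ne_top _ hI)
  refine ⟨V, fun a => h1 ⟨a, rfl⟩, fun a ha => h2 ⟨e a, ?_, rfl⟩⟩
  change e.symm (e a) ∈ I
  rwa [e.symm_apply_apply]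

/-! ### Valuations of polynomials in one function. -/

section Valuation

variable {F K : Type*} [Field F] [Field K] [Algebra F K] (V : ValuationSubring K)

theorem aeval_mem_valuationSubring (hF : ∀ t : F, algebraMap F K t ∈ V) {z : K} (hz : z ∈ V)
    (p : F[X]) : aeval z p ∈ V := by
  rw [aeval_eq_sum_range]
  refine sum_mem fun i _ => ?_
  rw [Algebra.smul_def]
  exact mul_mem (hF _) (pow_mem hz i)

theorem valuation_algebraMap_eq_one (hF : ∀ t : F, algebraMap F K t ∈ V) {t : F} (ht : t ≠ 0) :
    V.valuation (algebraMap F K t) = 1 := by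
  have h := (V.valuation_le_one_iff _).2 (hF t⁻¹)
  refine le_antisymm ((V.valuation_le_one_iff _).2 (hF t)) ?_
  rw [map_inv₀, map_inv₀] at h
  refine (inv_le_one₀ ((Valuation.pos_iff _).2 ?_)).1 h
  rwa [Ne, map_eq_zero]

/-- In `p(z) = z * p₁(z) + p(0)` the nonzero constant dominates. -/
theorem valuation_aeval_eq_one (hF : ∀ t : F, algebraMap F K t ∈ V) {z : K} (hz : z ∈ V.nonunits)
    {p : F[X]} (hp : p.coeff 0 ≠ 0) : V.valuation (aeval z p) = 1 := by
  rw [← divX_mul_X_add p, map_add, map_mul, aeval_X, aeval_C]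
  have h1 := valuation_algebraMap_eq_one V hF hp
  rw [Valuation.map_add_eq_of_lt_right, h1]
  rw [map_mul, h1]
  exact mul_lt_one_of_nonneg_of_lt_one_right
    ((V.valuation_le_one_iff _).2 (aeval_mem_valuationSubring V hF (V.nonunits_le hz) _)) zero_le
    (V.mem_nonunits_iff.1 hz)

/-- At a pole of `z`, `p(z)` is `z ^ deg p` times the reversed polynomial at `1 / z`. The latter is
a unit because its constant term is the leading coefficient of `p`. -/
theorem natDegree_le_of_aeval_div_mem (hF : ∀ t : F, algebraMap F K t ∈ V) {z : K} (hz0 : z ≠ 0)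
    (hz : z⁻¹ ∈ V.nonunits) {p : F[X]} (hp : p ≠ 0) {n : ℕ} (h : aeval z p / z ^ n ∈ V) :
    p.natDegree ≤ n := by
  have h1 : aeval z p = aeval z⁻¹ p.reverse * z ^ p.natDegree := by
    let := invertibleOfNonzero hz0
    have := eval₂_reverse_mul_pow (algebraMap F K) z p
    rw [invOf_eq_inv] at this
    exact this.symm
  have h2 : V.valuation (aeval z⁻¹ p.reverse) = 1 :=
    valuation_aeval_eq_one V hF hz (by simpa using hp)
  by_contra! hlt
  obtain ⟨k, hk⟩ := Nat.exists_eq_add_of_lt hlt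
  rw [← V.valuation_le_one_iff, h1, map_div₀, map_mul, h2, one_mul, ← map_div₀, hk, add_assoc,
    pow_add, mul_div_cancel_left₀ _ (pow_ne_zero _ hz0), map_pow] at h
  have h3 := V.mem_nonunits_iff.1 hz
  rw [map_inv₀] at h3
  have h4 : 1 < V.valuation z := (inv_lt_one₀ ((Valuation.pos_iff _).2 hz0)).1 h3
  exact absurd h (not_le.2 (one_lt_pow₀ h4 k.succ_ne_zero))

end Valuation

/-! ### Divisibility, the trace polynomial and the degree inequality. -/

theorem dvd_of_pow_dvd_pow_mul_squarefree {R : Type*} [CommRing R] [IsDomain R]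
    [IsPrincipalIdealRing R] {s a g : R} {c i : ℕ} (hg : Squarefree g)
    (hs : s ≠ 0) (hi : i < c) (h : s ^ c ∣ a ^ c * g ^ i) : s ∣ a := by
  obtain ⟨e, s', a', he, hcop, rfl, rfl⟩ :
      ∃ e s' a', e ≠ 0 ∧ IsCoprime s' a' ∧ s = e * s' ∧ a = e * a' := by
    obtain ⟨s', a', e, hrel, rfl, rfl⟩ := UniqueFactorizationMonoid.exists_reduced_factors s hs a
    exact ⟨e, s', a', left_ne_zero_of_mul hs, hrel.isCoprime, rfl, rfl⟩
  have h1 : s' ^ c ∣ g ^ i := by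
    rw [mul_pow, mul_pow, mul_assoc, mul_dvd_mul_iff_left (pow_ne_zero _ he)] at h
    exact (hcop.pow).dvd_of_dvd_mul_left h
  -- A prime factor of `s'` would have multiplicity at least `c` in `g ^ i`, but it divides `g` at
  -- most once and `i < c`.
  have hu : IsUnit s' := by
    by_contra hu
    have hs' : s' ≠ 0 := right_ne_zero_of_mul hs
    obtain ⟨π, hπ, hd⟩ := WfDvdMonoid.exists_irreducible_factor hu hs'
    have h2 : π ^ c ∣ g ^ i := (pow_dvd_pow_of_dvd hd c).trans h1
    have h3 : emultiplicity π g ≤ 1 :=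
      ((squarefree_iff_emultiplicity_le_one g).1 hg π).resolve_right hπ.not_isUnit
    have h4 := le_emultiplicity_of_pow_dvd h2
    rw [emultiplicity_pow hπ.prime] at h4
    have h5 : (c : ℕ∞) ≤ i := h4.trans (by simpa using mul_le_mul_right h3 (i : ℕ∞))
    exact absurd (Nat.cast_le.1 h5) (by omega)
  exact mul_dvd_mul_left _ (hu.dvd)

/-- The quotient already lies in the fraction field of `R`, where integral elements belong to `R`.
-/
theorem exists_mul_eq_of_isIntegral {R K : Type*} [CommRing R] [IsDomain R] [IsIntegrallyClosed R]
    [Field K] [Algebra R K] (hinj : Function.Injective (algebraMap R K)) {a s : R} (hs : s ≠ 0)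
    (h : IsIntegral R (algebraMap R K a / algebraMap R K s)) : s ∣ a := by
  let φ : FractionRing R →ₐ[R] K := IsFractionRing.liftAlgHom (g := Algebra.ofId R K) hinj
  have h1 : φ (algebraMap R _ a / algebraMap R _ s) = algebraMap R K a / algebraMap R K s := by
    rw [map_div₀, φ.commutes, φ.commutes]
  rw [← h1, isIntegral_algHom_iff φ φ.toRingHom.injective] at h
  obtain ⟨b, hb⟩ := IsIntegrallyClosed.isIntegral_iff.1 h
  have hs' : algebraMap R (FractionRing R) s ≠ 0 := by simpa using hs
  rw [eq_div_iff hs', ← map_mul] at hb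
  exact ⟨b, by rw [mul_comm, IsFractionRing.injective R (FractionRing R) hb]⟩

theorem normExp_eq_sum (q r : ℕ) (hq : 2 ≤ q) : normExp q r = ∑ i ∈ Finset.range r, q ^ i :=
  (Nat.geomSum_eq hq r).symm

theorem pow_lt_normExp (q r i : ℕ) (hq : 2 ≤ q) (hr : 2 ≤ r) (hi : i < r) : q ^ i < normExp q r := by
  rw [normExp_eq_sum q r hq]
  have : 0 < q := by omega
  -- A second summand exists because `r ≥ 2`; it makes the inequality strict.
  obtain ⟨j, hj, hij⟩ : ∃ j, j ∈ Finset.range r ∧ i ≠ j :=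
    ⟨if i = 0 then 1 else 0, by split_ifs <;> simp <;> omega, by split_ifs <;> omega⟩
  exact Finset.single_lt_sum hij.symm (Finset.mem_range.2 hi) hj (by positivity) (fun _ _ _ => by positivity)

theorem natDegree_tracePoly (F : Type*) [Field F] (q r : ℕ) (hq : 2 ≤ q) (hr : r ≠ 0) :
    (tracePoly F q r).natDegree = q ^ (r - 1) := by
  obtain ⟨k, rfl⟩ := Nat.exists_eq_succ_of_ne_zero hr
  rw [tracePoly, Finset.sum_range_succ, natDegree_add_eq_right_of_natDegree_lt]
  · simp
  · rw [natDegree_X_pow]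
    refine (natDegree_sum_le_of_forall_le (n := q ^ k - 1) _ _ fun i hi => ?_).trans_lt ?_
    · rw [natDegree_X_pow]
      have := Nat.pow_lt_pow_right (a := q) (by omega) (Finset.mem_range.1 hi)
      omega
    · have : 0 < q ^ k := by positivity
      omega

/-- All terms but the linear one have zero derivative, so the derivative is 1. -/
theorem squarefree_tracePoly {F : Type*} [Field F] (q r : ℕ) (hq : (q : F) = 0) (hr : r ≠ 0) :
    Squarefree (tracePoly F q r) := by
  refine Separable.squarefree ?_
  have : derivative (tracePoly F q r) = 1 := by
    rw [tracePoly, derivative_sum, Finset.sum_eq_single 0]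
    · simp
    · intro i _ hi
      rw [derivative_X_pow, Nat.cast_pow, hq, zero_pow hi, C_0, zero_mul]
    · intro h
      simp at h
      omega
  rw [separable_def, this]
  exact isCoprime_one_right

/-- Put `M = q ^ (r - 1)` and `j = d - e ≤ q - 1`. From `(q - 1) c = q M - 1` one gets `c / M < q /
(q - 1)`. For `j > 0` the hypothesis thus gives `i ≤ j c / M < j + j / (q - 1) ≤ j + 1`; for `j = 0`
it gives `i = 0`. -/
theorem add_le_of_degree_bound {q r d i e : ℕ} (hq : 2 ≤ q) (hr : 2 ≤ r) (hd : d < q)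
    (h : normExp q r * e + i * q ^ (r - 1) ≤ d * normExp q r) : i + e ≤ d := by
  have hc := normExp_mul q r
  obtain ⟨k, rfl⟩ := Nat.exists_eq_add_of_le' (show 1 ≤ r by omega)
  have h0 : 0 < normExp q (k + 1) := (pow_lt_normExp q (k+1) 0 hq hr (by omega)).pos
  rw [Nat.add_sub_cancel] at h
  have hM : 0 < q ^ k := by positivity
  obtain ⟨n, rfl⟩ := Nat.exists_eq_add_of_le' (show 1 ≤ q by omega)
  rw [Nat.add_sub_cancel, pow_succ] at hc
  have hc' : n * normExp (n + 1) (k + 1) + 1 = (n + 1) ^ k * (n + 1) := by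
    have : 0 < (n + 1) ^ k * (n + 1) := by positivity
    omega
  generalize (n + 1) ^ k = M at *
  generalize normExp (n + 1) (k + 1) = c at *
  have hed : e ≤ d := by
    by_contra! h1
    nlinarith
  obtain ⟨j, rfl⟩ := Nat.exists_eq_add_of_le hed
  by_contra! h1
  have h2 : j + 1 ≤ i := by omega
  have h3 : (j + 1) * M ≤ j * c := by nlinarith
  have h4 : n * ((j + 1) * M) + j ≤ j * (M * (n + 1)) := by
    rw [← hc']; nlinarith
  have h5 : j * M ≤ n * M := Nat.mul_le_mul_right _ (by omega)
  nlinarith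

/-! ### Sections on the normalization are forms when `d < q`. -/

section RegularFunctions

variable (F : Type*) [Field F] (q r : ℕ) [Fact (IsPrimePow q)] [Fact (2 ≤ r)]

/-- The functions that are regular where `x` and `y` are and have a pole of order at most that
of `y ^ d` where `y` has a pole. -/
noncomputable def regularFunctions (d : ℕ) : Submodule F (FunField F q r) where
  carrier := {f | ∀ V : ValuationSubring (FunField F q r),
    (∀ t : F, algebraMap F (FunField F q r) t ∈ V) →
    (xFun F q r ∈ V → yFun F q r ∈ V → f ∈ V) ∧
    ((yFun F q r)⁻¹ ∈ V.nonunits → f / yFun F q r ^ d ∈ V)}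
  add_mem' hf hg V hV := ⟨fun hx hy => add_mem ((hf V hV).1 hx hy) ((hg V hV).1 hx hy),
    fun hy => by rw [add_div]; exact add_mem ((hf V hV).2 hy) ((hg V hV).2 hy)⟩
  zero_mem' V hV := ⟨fun _ _ => zero_mem V, fun _ => by rw [zero_div]; exact zero_mem V⟩
  smul_mem' t f hf V hV := ⟨fun hx hy => by
      rw [Algebra.smul_def]; exact mul_mem (hV t) ((hf V hV).1 hx hy),
    fun hy => by rw [Algebra.smul_def, mul_div_assoc]; exact mul_mem (hV t) ((hf V hV).2 hy)⟩

variable {F q r} in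
theorem Place.vanishing_zero (v : Place F q r) (d : ℕ) : v.vanishing d 0 = v.stalkOne ^ d := by
  rw [vanishing, pow_zero, Ideal.one_eq_top, Submodule.top_smul]

theorem yFun_ne_zero : yFun F q r ≠ 0 := by
  rw [← aeval_X (R := F) (yFun F q r), Ne, map_eq_zero_iff _ (aeval_yFun_injective F q r)]
  exact X_ne_zero

theorem aeval_yFun_tracePoly :
    aeval (yFun F q r) (tracePoly F q r) = ∑ i ∈ Finset.range r, yFun F q r ^ q ^ i := by
  simp [tracePoly]

/-- Dividing the equation by `y ^ c` writes `(x / y) ^ c` as a polynomial in `1 / y`, since every `q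
^ i` is below `c`. -/
theorem xFun_div_yFun_mem (hq : 2 ≤ q) (hr : 2 ≤ r) (V : ValuationSubring (FunField F q r))
    (hy : (yFun F q r)⁻¹ ∈ V) : xFun F q r / yFun F q r ∈ V := by
  have h : (xFun F q r / yFun F q r) ^ normExp q r ∈ V := by
    rw [div_pow, xFun_pow_normExp, aeval_yFun_tracePoly, Finset.sum_div]
    refine sum_mem fun i hi => ?_
    obtain ⟨k, hk⟩ := Nat.exists_eq_add_of_le (pow_lt_normExp q r i hq hr (Finset.mem_range.1 hi)).le
    rw [hk, pow_add, div_mul_eq_div_div, div_self (pow_ne_zero _ (yFun_ne_zero F q r)), one_div,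
      ← inv_pow]
    exact pow_mem hy k
  rw [← V.valuation_le_one_iff, map_pow] at h
  rw [← V.valuation_le_one_iff]
  exact (pow_le_one_iff (normExp_pos q r).ne').1 h

variable {F q r} in
theorem Place.stalkOne_eq_span_one (v : Place F q r) (hx : xFun F q r ∈ v.ring)
    (hy : yFun F q r ∈ v.ring) : v.stalkOne = Submodule.span v.ring {1} := by
  refine le_antisymm (Submodule.span_le.2 ?_) (Submodule.span_mono ?_)
  · rintro _ ⟨i, rfl⟩
    refine Submodule.mem_span_singleton.2 ?_
    fin_cases i
    · exact ⟨⟨_, hx⟩, mul_one _⟩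
    · exact ⟨⟨_, hy⟩, mul_one _⟩
    · exact ⟨1, mul_one _⟩
  · rintro _ rfl
    exact ⟨2, rfl⟩

theorem sectionsNorm_le_regularFunctions (d a b : ℕ) :
    sectionsNorm F q r d a b ≤ regularFunctions F q r d := by
  have hq : 2 ≤ q := (Fact.out : IsPrimePow q).two_le
  intro f hf V hV
  by_cases htop : V = ⊤
  · subst htop
    exact ⟨fun _ _ => ValuationSubring.mem_top _, fun _ => ValuationSubring.mem_top _⟩
  let v : Place F q r := ⟨V, hV, htop⟩
  have hfd : f ∈ v.stalkOne ^ d := by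
    rw [← v.vanishing_zero]
    exact (hf v).1
  constructor
  · intro hx hy
    have h2 := hfd
    rw [v.stalkOne_eq_span_one hx hy, Submodule.span_pow, Set.singleton_pow, one_pow] at h2
    obtain ⟨t, rfl⟩ := Submodule.mem_span_singleton.1 h2
    exact mul_mem t.2 (one_mem V)
  · intro hy
    have hy0 := yFun_ne_zero F q r
    -- At a pole of `y`, both `x / y` and `1 / y` are regular, so `y` generates the stalk.
    have h1 : v.stalkOne ≤ Submodule.span v.ring {yFun F q r} := by
      refine Submodule.span_le.2 ?_
      rintro _ ⟨i, rfl⟩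
      refine Submodule.mem_span_singleton.2 ?_
      fin_cases i
      · exact ⟨⟨_, xFun_div_yFun_mem F q r hq Fact.out V (V.nonunits_le hy)⟩, div_mul_cancel₀ _ hy0⟩
      · exact ⟨1, one_mul _⟩
      · exact ⟨⟨_, V.nonunits_le hy⟩, inv_mul_cancel₀ hy0⟩
    have h2 := pow_le_pow_left' h1 d hfd
    rw [Submodule.span_pow, Set.singleton_pow] at h2
    obtain ⟨t, rfl⟩ := Submodule.mem_span_singleton.1 h2
    change (t : FunField F q r) * _ / _ ∈ V
    rw [mul_div_cancel_right₀ _ (pow_ne_zero _ hy0)]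
    exact t.2

/-- Apply the conditions on `f` to the valuation ring pulled back along `σ`. They involve only `x`
and `y`, which `σ` scales by a constant and fixes respectively. -/
theorem map_mem_regularFunctions (d : ℕ) (σ : FunField F q r →ₐ[F] FunField F q r) {ζ : F}
    (hx : σ (xFun F q r) = ζ • xFun F q r) (hy : σ (yFun F q r) = yFun F q r)
    {f : FunField F q r} (hf : f ∈ regularFunctions F q r d) : σ f ∈ regularFunctions F q r d := by
  intro V hV
  have h := hf (V.comap σ.toRingHom) fun t => by
    change σ (algebraMap F _ t) ∈ V
    rw [σ.commutes]
    exact hV t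
  refine ⟨fun h1 h2 => h.1 ?_ ?_, fun h1 => ?_⟩
  · change σ _ ∈ V
    rw [hx, Algebra.smul_def]
    exact mul_mem (hV ζ) h1
  · change σ _ ∈ V
    rwa [hy]
  · have h2 : σ (f / yFun F q r ^ d) ∈ V := h.2 (by
      rw [ValuationSubring.inv_mem_nonunits_iff] at h1 ⊢
      change _ ∨ ¬ σ (yFun F q r) ∈ V
      rwa [hy])
    rwa [map_div₀, map_pow, hy] at h2

/-- Since `1 / y` is transcendental, `F[1 / y]` is a polynomial ring, and a valuation ring exists
above its ideal `(1 / y)`. -/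
theorem exists_valuationSubring_inv_yFun : ∃ V : ValuationSubring (FunField F q r),
    (∀ t : F, algebraMap F (FunField F q r) t ∈ V) ∧ (yFun F q r)⁻¹ ∈ V.nonunits := by
  have htr : Transcendental F (yFun F q r)⁻¹ := by
    rw [Transcendental, IsAlgebraic.inv_iff]
    exact transcendental_iff_injective.2 (aeval_yFun_injective F q r)
  obtain ⟨V, h1, h2⟩ := exists_valuationSubring_of_injective
    (aeval (R := F) (yFun F q r)⁻¹).toRingHom (transcendental_iff_injective.1 htr)
    (Ideal.span {X}) (fun h => by
      rw [Ideal.span_singleton_eq_top] at h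
      exact not_isUnit_X h)
  refine ⟨V, fun t => ?_, ?_⟩
  · simpa using h1 (C t)
  · simpa using h2 X (Ideal.mem_span_singleton_self X)

/-- An element outside the integral closure of `F[y]` is missed by some valuation ring containing
that closure. Such a ring contains `y` and also `x`, because `x ^ c = Tr y`, hence contains `f`. -/
theorem isIntegral_of_mem_regularFunctions {d : ℕ} {f : FunField F q r}
    (hf : f ∈ regularFunctions F q r d) : (aeval (R := F) (yFun F q r)).toRingHom.IsIntegralElem f := by
  let := (aeval (R := F) (yFun F q r)).toRingHom.toAlgebra
  change IsIntegral F[X] f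
  by_contra h
  have : IsIntegrallyClosedIn (integralClosure F[X] (FunField F q r)).toSubring (FunField F q r) :=
    inferInstanceAs (IsIntegrallyClosedIn (integralClosure F[X] (FunField F q r)) (FunField F q r))
  obtain ⟨V, hV, hfV⟩ := Subring.exists_le_valuationSubring_of_isIntegrallyClosedIn
    (R := (integralClosure F[X] (FunField F q r)).toSubring) (x := f) h
  have hp : ∀ p : F[X], aeval (yFun F q r) p ∈ V := fun p =>
    hV (isIntegral_algebraMap (R := F[X]) (A := FunField F q r) (x := p))
  refine hfV ((hf V fun t => ?_).1 (hV ?_) ?_)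
  · simpa using hp (C t)
  · change IsIntegral F[X] (xFun F q r)
    refine IsIntegral.of_pow (normExp_pos q r) ?_
    rw [xFun_pow_normExp]
    exact isIntegral_algebraMap (R := F[X]) (A := FunField F q r)
  · simpa using hp X

theorem monomial_mem_forms (hchar : (q : F) = 0) {d i : ℕ} (hd : d < q) (hi : i < normExp q r)
    {a s : F[X]} (hs : s ≠ 0)
    (h : aeval (yFun F q r) a / aeval (yFun F q r) s * xFun F q r ^ i ∈ regularFunctions F q r d) :
    aeval (yFun F q r) a / aeval (yFun F q r) s * xFun F q r ^ i ∈ forms F q r d := by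
  have hq : 2 ≤ q := (Fact.out : IsPrimePow q).two_le
  have hr : 2 ≤ r := Fact.out
  have hinj := aeval_yFun_injective F q r
  have hpow : ∀ u : F[X], (aeval (yFun F q r) u * xFun F q r ^ i) ^ normExp q r =
      aeval (yFun F q r) (u ^ normExp q r * tracePoly F q r ^ i) := fun u => by
    rw [mul_pow, ← pow_mul, mul_comm i, pow_mul, xFun_pow_normExp, map_mul, map_pow, map_pow]
  have hdvd : s ∣ a := by
    refine dvd_of_pow_dvd_pow_mul_squarefree (squarefree_tracePoly q r hchar (by omega)) hs hi ?_
    have hint := isIntegral_of_mem_regularFunctions F q r h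
    let := (aeval (R := F) (yFun F q r)).toRingHom.toAlgebra
    refine exists_mul_eq_of_isIntegral (K := FunField F q r) hinj (pow_ne_zero _ hs) ?_
    have h2 := IsIntegral.pow (R := F[X]) hint (normExp q r)
    rwa [div_mul_eq_mul_div, div_pow, hpow, ← map_pow] at h2
  obtain ⟨e, rfl⟩ := hdvd
  have hs' : aeval (yFun F q r) s ≠ 0 := by
    rwa [Ne, map_eq_zero_iff _ hinj]
  rw [map_mul, mul_div_cancel_left₀ _ hs'] at h ⊢
  by_cases he : e = 0
  · rw [he, map_zero, zero_mul]
    exact zero_mem _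
  -- Compare `c`-th powers at a pole of `y`: `e ^ c * Tr ^ i` is a polynomial in `y`, so its degree
  -- is at most `d c`.
  have hdeg : i + e.natDegree ≤ d := by
    obtain ⟨V, hV, hy⟩ := exists_valuationSubring_inv_yFun F q r
    have h1 := pow_mem ((h V hV).2 hy) (normExp q r)
    rw [div_pow, hpow, ← pow_mul] at h1
    have hT : tracePoly F q r ≠ 0 := (squarefree_tracePoly q r hchar (by omega)).ne_zero
    have h2 := natDegree_le_of_aeval_div_mem V hV (yFun_ne_zero F q r) hy
      (mul_ne_zero (pow_ne_zero _ he) (pow_ne_zero _ hT)) h1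
    rw [natDegree_mul (pow_ne_zero _ he) (pow_ne_zero _ hT), natDegree_pow, natDegree_pow,
      natDegree_tracePoly F q r hq (by omega)] at h2
    exact add_le_of_degree_bound hq hr hd h2
  rw [aeval_eq_sum_range, Finset.sum_mul]
  refine sum_mem fun j hj => ?_
  rw [smul_mul_assoc, mul_comm]
  have := Finset.mem_range.1 hj
  exact Submodule.smul_mem _ _ (Submodule.subset_span ⟨i, j, by omega, rfl⟩)

theorem natCast_eq_zero [Finite F] (hF : Nat.card F = q ^ r) : (q : F) = 0 := by
  have h : (Nat.card F : F) = 0 := by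
    have := Fintype.ofFinite F
    rw [Nat.card_eq_fintype_card]
    exact Nat.cast_card_eq_zero F
  rw [hF, Nat.cast_pow] at h
  exact (pow_eq_zero_iff (by have : 2 ≤ r := Fact.out; omega)).1 h

theorem regularFunctions_le_forms [Finite F] (hF : Nat.card F = q ^ r) {d : ℕ} (hd : d < q) :
    regularFunctions F q r d ≤ forms F q r d := by
  have hq : 2 ≤ q := (Fact.out : IsPrimePow q).two_le
  have hr : r ≠ 0 := by have : 2 ≤ r := Fact.out; omega
  intro f hf
  obtain ⟨ζ, hζ⟩ := exists_isPrimitiveRoot_normExp q r hq hr hF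
  obtain ⟨σ, hx, hy⟩ := exists_twist F q r ζ hζ.pow_eq_one
  obtain ⟨s, a, hs, rfl⟩ := exists_coordinates_fraction F q r f
  have hσ : ∀ p : F[X], σ (aeval (yFun F q r) p) = aeval (yFun F q r) p := fun p => by
    rw [← aeval_algHom_apply, hy]
  refine sum_mem fun i hi => monomial_mem_forms F q r (natCast_eq_zero F q r hF) hd
    (Finset.mem_range.1 hi) hs ?_
  refine mem_of_sum_eigenvectors_mem σ.toLinearMap (regularFunctions F q r d)
    (fun v hv => map_mem_regularFunctions F q r d σ hx hy hv) (Finset.range (normExp q r))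
    (fun i => ζ ^ i) (fun i hi j hj h => hζ.pow_inj (by simpa using hi) (by simpa using hj) h)
    (fun i => aeval (yFun F q r) (a i) / aeval (yFun F q r) s * xFun F q r ^ i)
    (fun i _ => ?_) hf hi
  change σ _ = _
  rw [map_mul, map_div₀, hσ, hσ, map_pow, hx, _root_.smul_pow, mul_smul_comm]

theorem sectionsNorm_eq_sectionsCurve [Finite F] (hF : Nat.card F = q ^ r) {d : ℕ} (hd : d < q)
    (a b : ℕ) : sectionsNorm F q r d a b = sectionsCurve F q r d a b :=
  (inf_eq_right.2 ((sectionsNorm_le_regularFunctions F q r d a b).trans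
    (regularFunctions_le_forms F q r hF hd))).symm

end RegularFunctions

/-! ### Stalks, vanishing orders and division by `y`. -/

section Stalks

variable {F : Type*} [Field F] {q r : ℕ} [Fact (IsPrimePow q)] [Fact (2 ≤ r)]

theorem Place.stalkOne_eq_span (v : Place F q r) {P : Fin 3 → F} (hP : v.LiesOver P) {i : Fin 3}
    (hi : P i = 1) : v.stalkOne = Submodule.span v.ring {genericPoint F q r i} := by
  refine le_antisymm ?_ (Submodule.span_mono (by
    rintro _ rfl
    exact ⟨i, rfl⟩))
  -- Nakayama: modulo the maximal ideal, each coordinate is a constant multiple of the one that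
  -- equals 1 at `P`.
  refine Submodule.le_of_le_smul_of_le_jacobson_bot
    (I := IsLocalRing.maximalIdeal v.ring) (Submodule.fg_span (Set.finite_range _))
    (IsLocalRing.maximalIdeal_le_jacobson _) ?_
  refine Submodule.span_le.2 ?_
  rintro _ ⟨j, rfl⟩
  have h := hP i j
  rw [hi, one_smul, vanishing, pow_one, pow_one] at h
  have h2 : P j • genericPoint F q r i ∈ Submodule.span v.ring {genericPoint F q r i} :=
    Submodule.mem_span_singleton.2 ⟨⟨_, v.constants_mem (P j)⟩, (Algebra.smul_def _ _).symm⟩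
  rw [← sub_add_cancel (genericPoint F q r j) (P j • genericPoint F q r i), add_comm]
  exact Submodule.add_mem_sup h2 h

theorem Place.mem_vanishing_iff (v : Place F q r) {s : FunField F q r}
    (hs : v.stalkOne = Submodule.span v.ring {s}) {d n : ℕ} {f : FunField F q r} :
    f ∈ v.vanishing d n ↔ ∃ t ∈ IsLocalRing.maximalIdeal v.ring ^ n, (t : FunField F q r) * s ^ d = f := by
  rw [vanishing, hs, Submodule.span_pow, Set.singleton_pow, Submodule.mem_smul_span_singleton]
  rfl

theorem Place.forms_le_stalkOne_pow (v : Place F q r) {d : ℕ} {f : FunField F q r}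
    (hf : f ∈ forms F q r d) : f ∈ v.stalkOne ^ d := by
  have hg : ∀ i, genericPoint F q r i ∈ v.stalkOne := fun i => Submodule.subset_span ⟨i, rfl⟩
  induction hf using Submodule.span_induction with
  | zero => exact zero_mem _
  | add f g _ _ h1 h2 => exact add_mem h1 h2
  | smul t f _ h =>
    rw [Algebra.smul_def]
    exact (v.stalkOne ^ d).smul_mem ⟨_, v.constants_mem t⟩ h
  | mem f h =>
    obtain ⟨i, j, hij, rfl⟩ := h
    obtain ⟨k, rfl⟩ := Nat.exists_eq_add_of_le hij
    rw [pow_add, pow_add, ← mul_one (xFun F q r ^ i * _), ← one_pow k]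
    exact Submodule.mul_mem_mul (Submodule.mul_mem_mul (Submodule.pow_mem_pow _ (hg 0) _)
      (Submodule.pow_mem_pow _ (hg 1) _)) (Submodule.pow_mem_pow _ (hg 2) _)

theorem Place.liesOver_affine_iff (v : Place F q r) (s t : F) :
    v.LiesOver ![s, t, 1] ↔ xFun F q r - algebraMap F _ s ∈ v.ring.nonunits ∧
      yFun F q r - algebraMap F _ t ∈ v.ring.nonunits := by
  constructor
  · intro h
    have hs := v.stalkOne_eq_span h (i := 2) rfl
    have key : ∀ i, genericPoint F q r i - algebraMap F _ ((![s, t, 1] : Fin 3 → F) i) ∈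
        v.ring.nonunits := by
      intro i
      obtain ⟨u, hu, h1⟩ := (v.mem_vanishing_iff hs).1 (h 2 i)
      rw [pow_one] at hu
      rw [Algebra.smul_def, Algebra.smul_def] at h1
      change (u : FunField F q r) * (1 : FunField F q r) ^ 1 =
        algebraMap F _ 1 * _ - _ * (1 : FunField F q r) at h1
      rw [map_one, one_mul, one_pow, mul_one, mul_one] at h1
      rw [← h1]
      exact ValuationSubring.coe_mem_nonunits_iff.2 hu
    exact ⟨key 0, key 1⟩
  · rintro ⟨hx, hy⟩ i j
    have hx' : xFun F q r ∈ v.ring := by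
      have := v.ring.add_mem _ _ (v.ring.nonunits_le hx) (v.constants_mem s)
      rwa [sub_add_cancel] at this
    have hy' : yFun F q r ∈ v.ring := by
      have := v.ring.add_mem _ _ (v.ring.nonunits_le hy) (v.constants_mem t)
      rwa [sub_add_cancel] at this
    have key : ∀ i, genericPoint F q r i - algebraMap F _ ((![s, t, 1] : Fin 3 → F) i) ∈
        v.ring.nonunits := by
      intro i
      fin_cases i
      · exact hx
      · exact hy
      · change (1 : FunField F q r) - algebraMap F _ 1 ∈ _
        rw [map_one, sub_self]
        exact zero_mem _
    generalize (![s, t, 1] : Fin 3 → F) = P at *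
    have h1 : P i • genericPoint F q r j - P j • genericPoint F q r i ∈ v.ring.nonunits := by
      have : P i • genericPoint F q r j - P j • genericPoint F q r i =
          algebraMap F _ (P i) * (genericPoint F q r j - algebraMap F _ (P j)) -
          algebraMap F _ (P j) * (genericPoint F q r i - algebraMap F _ (P i)) := by
        rw [Algebra.smul_def, Algebra.smul_def]
        ring
      rw [this]
      have hm : ∀ (t : F) (z : FunField F q r), z ∈ v.ring.nonunits →
          algebraMap F _ t * z ∈ v.ring.nonunits := fun t z hz => by
        rw [ValuationSubring.mem_nonunits_iff, map_mul] at *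
        exact (mul_le_of_le_one_left' ((v.ring.valuation_le_one_iff _).2 (v.constants_mem t))).trans_lt hz
      exact sub_mem (hm _ _ (key j)) (hm _ _ (key i))
    obtain ⟨u, hu⟩ := ValuationSubring.mem_nonunits_iff_exists_mem_maximalIdeal.1 h1
    refine (v.mem_vanishing_iff (v.stalkOne_eq_span_one hx' hy')).2 ⟨⟨_, u⟩, by rwa [pow_one], ?_⟩
    simp

theorem tracePoly_eq_X_mul : ∃ u : F[X], u.coeff 0 ≠ 0 ∧
    tracePoly F q r = X * u := by
  refine ⟨(tracePoly F q r).divX, ?_, ?_⟩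
  · rw [coeff_divX, zero_add, coeff_one_tracePoly]
    exact one_ne_zero
  · rw [X_mul]
    conv_lhs => rw [← divX_mul_X_add (tracePoly F q r), coeff_zero_tracePoly, C_0, add_zero]

/-- Here `x ^ c = Tr y = y * u(y)` with `u(0) ≠ 0`, so `u(y)` is a unit wherever `y` vanishes. -/
theorem exists_yFun_eq (V : ValuationSubring (FunField F q r))
    (hV : ∀ t : F, algebraMap F (FunField F q r) t ∈ V) (hy : yFun F q r ∈ V.nonunits) :
    ∃ w ∈ V, yFun F q r = xFun F q r ^ normExp q r * w := by
  obtain ⟨u, hu0, hu⟩ := tracePoly_eq_X_mul (F := F) (q := q) (r := r)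
  have h1 := valuation_aeval_eq_one V hV hy hu0
  have h0 : aeval (yFun F q r) u ≠ 0 := fun h => by simp [h] at h1
  refine ⟨(aeval (yFun F q r) u)⁻¹, ?_, ?_⟩
  · rw [← V.valuation_le_one_iff, map_inv₀, h1, inv_one]
  · rw [xFun_pow_normExp, hu, map_mul, aeval_X, mul_inv_cancel_right₀ h0]

theorem mul_yFun_mem_sectionsCurve {d a b : ℕ} (hb : b ≤ normExp q r) {g : FunField F q r}
    (hg : g ∈ sectionsCurve F q r d a 0) : yFun F q r * g ∈ sectionsCurve F q r (d + 1) a b := by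
  have hform : yFun F q r * g ∈ forms F q r (d + 1) := by
    have h := hg.1
    clear hg
    induction h using Submodule.span_induction with
    | zero => simp
    | add f g _ _ h1 h2 => rw [mul_add]; exact add_mem h1 h2
    | smul t f _ h => rw [mul_smul_comm]; exact Submodule.smul_mem _ _ h
    | mem f h =>
      obtain ⟨i, j, hij, rfl⟩ := h
      exact Submodule.subset_span ⟨i, j + 1, by omega, by ring⟩
  refine ⟨hform, fun v => ⟨?_, fun hv => ?_, fun hv => ?_⟩⟩
  · rw [v.vanishing_zero]
    exact v.forms_le_stalkOne_pow hform
  -- At `P_∞` the generator of the stalk is `y`, so the new factor is absorbed by `y ^ (d + 1)` and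
  -- the coefficient `t` is unchanged.
  · have hs := v.stalkOne_eq_span hv (i := 1) rfl
    obtain ⟨t, ht, h⟩ := (v.mem_vanishing_iff hs).1 ((hg.2 v).2.1 hv)
    refine (v.mem_vanishing_iff hs).2 ⟨t, ht, ?_⟩
    rw [← h]
    change _ * yFun F q r ^ _ = _ * (_ * yFun F q r ^ _)
    ring
  · have hs := v.stalkOne_eq_span hv (i := 2) rfl
    obtain ⟨t, ht, h⟩ := (v.mem_vanishing_iff hs).1 (hg.2 v).1
    rw [v.liesOver_affine_iff, map_zero, sub_zero, sub_zero] at hv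
    obtain ⟨w, hw, hyw⟩ := exists_yFun_eq v.ring v.constants_mem hv.2
    obtain ⟨hx, hxm⟩ := ValuationSubring.mem_nonunits_iff_exists_mem_maximalIdeal.1 hv.1
    refine (v.mem_vanishing_iff hs).2 ⟨⟨_, hx⟩ ^ normExp q r * (⟨w, hw⟩ * t), ?_, ?_⟩
    · exact Ideal.mul_mem_right _ _ (Ideal.pow_le_pow_right hb (Ideal.pow_mem_pow hxm _))
    · rw [← h, hyw]
      change xFun F q r ^ _ * (w * t) * (1 : FunField F q r) ^ _ =
        xFun F q r ^ _ * w * (t * (1 : FunField F q r) ^ _)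
      simp only [one_pow]
      ring

theorem div_yFun_mem_sectionsCurve {d a b : ℕ} {g : FunField F q r} (hform : g ∈ forms F q r d)
    (hg : yFun F q r * g ∈ sectionsCurve F q r (d + 1) a b) : g ∈ sectionsCurve F q r d a 0 := by
  have h0 : ∀ v : Place F q r, g ∈ v.vanishing d 0 := fun v => by
    rw [v.vanishing_zero]
    exact v.forms_le_stalkOne_pow hform
  refine ⟨hform, fun v => ⟨h0 v, fun hv => ?_, fun _ => h0 v⟩⟩
  have hs := v.stalkOne_eq_span hv (i := 1) rfl
  obtain ⟨t, ht, h⟩ := (v.mem_vanishing_iff hs).1 ((hg.2 v).2.1 hv)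
  refine (v.mem_vanishing_iff hs).2 ⟨t, ht, ?_⟩
  refine mul_left_cancel₀ (yFun_ne_zero F q r) ?_
  rw [← h]
  change _ * (_ * yFun F q r ^ _) = _ * yFun F q r ^ _
  ring

/-- Separates the monomials without `y` from those divisible by `y`. -/
theorem exists_eq_aeval_add_mul {d : ℕ} {f : FunField F q r} (hf : f ∈ forms F q r (d + 1)) :
    ∃ h : F[X], h.natDegree ≤ d + 1 ∧ ∃ g ∈ forms F q r d, f = aeval (xFun F q r) h + yFun F q r * g := by
  induction hf using Submodule.span_induction with
  | zero => exact ⟨0, by simp, 0, zero_mem _, by simp⟩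
  | add f f' _ _ h1 h2 =>
    obtain ⟨h, hd, g, hg, rfl⟩ := h1
    obtain ⟨h', hd', g', hg', rfl⟩ := h2
    exact ⟨h + h', natDegree_add_le_of_degree_le hd hd', g + g', add_mem hg hg', by rw [map_add]; ring⟩
  | smul t f _ h1 =>
    obtain ⟨h, hd, g, hg, rfl⟩ := h1
    exact ⟨t • h, (natDegree_smul_le _ _).trans hd, t • g, Submodule.smul_mem _ _ hg, by
      rw [map_smul, mul_smul_comm, smul_add]⟩
  | mem f h =>
    obtain ⟨i, j, hij, rfl⟩ := h
    cases j with
    | zero => exact ⟨X ^ i, by simpa using hij, 0, zero_mem _, by simp⟩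
    | succ j =>
      exact ⟨0, by simp, _, Submodule.subset_span ⟨i, j, by omega, rfl⟩, by simp; ring⟩

theorem xFun_ne_zero : xFun F q r ≠ 0 := by
  intro hx0
  have := xFun_pow_normExp F q r
  rw [hx0, zero_pow (normExp_pos q r).ne', eq_comm,
    map_eq_zero_iff _ (aeval_yFun_injective F q r)] at this
  have h1 := coeff_one_tracePoly F q r
  rw [this] at h1
  simp at h1

/-- With `h = X ^ k * u` and `u(0) ≠ 0`, the order of `h(x)` is exactly `k ≤ deg h < b`. -/
theorem aeval_eq_zero_of_mem_pow (v : Place F q r) (hx : xFun F q r ∈ v.ring.nonunits)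
    (hm : IsLocalRing.maximalIdeal v.ring = Ideal.span {⟨xFun F q r, v.ring.nonunits_le hx⟩}) {b : ℕ}
    {h : F[X]} (hb : h.natDegree < b) {t : v.ring}
    (ht : t ∈ IsLocalRing.maximalIdeal v.ring ^ b) (e : aeval (xFun F q r) h = t) : h = 0 := by
  by_contra h0
  obtain ⟨u, hu, hndvd⟩ := exists_eq_pow_rootMultiplicity_mul_and_not_dvd h h0 0
  rw [C_0, sub_zero] at hu hndvd
  set k := rootMultiplicity 0 h
  have hx0 : xFun F q r ≠ 0 := xFun_ne_zero
  have hx' : xFun F q r ∈ v.ring := v.ring.nonunits_le hx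
  have hk : k < b := by
    refine lt_of_le_of_lt ?_ hb
    have hu0 : u ≠ 0 := by rintro rfl; simp at hndvd
    rw [hu, natDegree_mul (pow_ne_zero _ X_ne_zero) hu0, natDegree_X_pow]
    omega
  obtain ⟨n, rfl⟩ := Nat.exists_eq_add_of_lt hk
  rw [hm, Ideal.span_singleton_pow, Ideal.mem_span_singleton] at ht
  obtain ⟨w, rfl⟩ := ht
  have hv := valuation_aeval_eq_one v.ring v.constants_mem hx (p := u) (by rwa [X_dvd_iff] at hndvd)
  have e' : aeval (xFun F q r) h = xFun F q r ^ (k + n + 1) * w := e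
  rw [hu, map_mul, map_pow, aeval_X, add_assoc, pow_add, mul_assoc] at e'
  rw [mul_left_cancel₀ (pow_ne_zero _ hx0) e', pow_succ', mul_assoc, map_mul] at hv
  refine hv.not_lt (mul_lt_one_of_nonneg_of_lt_one_left zero_le (v.ring.mem_nonunits_iff.1 hx)
    ((v.ring.valuation_le_one_iff _).2 (mul_mem (pow_mem hx' _) w.2)))

end Stalks

/-! ### Places above rational points. -/

section Points

variable {F : Type*} [Field F] {q r : ℕ} [Fact (IsPrimePow q)] [Fact (2 ≤ r)]

theorem eval₂_curvePoly_evalRingHom {s t : F}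
    (h : s ^ normExp q r = ∑ i ∈ Finset.range r, t ^ q ^ i) :
    (curvePoly F q r).eval₂ (evalRingHom t) s = 0 := by
  rw [eval₂_curvePoly, h, sub_eq_zero]
  simp [tracePoly]

/-- Evaluation of regular functions at an affine rational point of the curve. -/
noncomputable def evalPoint (s t : F) (h : s ^ normExp q r = ∑ i ∈ Finset.range r, t ^ q ^ i) :
    CoordRing F q r →ₐ[F] F :=
  { AdjoinRoot.lift (evalRingHom t) s (eval₂_curvePoly_evalRingHom h) with
    commutes' := fun u => by
      change AdjoinRoot.lift (evalRingHom t) s (eval₂_curvePoly_evalRingHom h)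
        (AdjoinRoot.of (curvePoly F q r) (C u)) = u
      rw [AdjoinRoot.lift_of]
      simp }

theorem evalPoint_root (s t : F) (h : s ^ normExp q r = ∑ i ∈ Finset.range r, t ^ q ^ i) :
    evalPoint s t h (AdjoinRoot.root (curvePoly F q r)) = s :=
  AdjoinRoot.lift_root (eval₂_curvePoly_evalRingHom h)

theorem evalPoint_of (s t : F) (h : s ^ normExp q r = ∑ i ∈ Finset.range r, t ^ q ^ i) (p : F[X]) :
    evalPoint s t h (AdjoinRoot.of (curvePoly F q r) p) = p.eval t :=
  AdjoinRoot.lift_of (eval₂_curvePoly_evalRingHom h)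

/-- Modulo `(x - s, y - t)` every function equals its value: the two ring homomorphisms agree on
constants, `x` and `y`. -/
theorem mem_ideal_of_evalPoint_eq_zero (s t : F)
    (h : s ^ normExp q r = ∑ i ∈ Finset.range r, t ^ q ^ i) {α : CoordRing F q r}
    (hα : evalPoint s t h α = 0) : α ∈ Ideal.span
      {AdjoinRoot.root (curvePoly F q r) - algebraMap F _ s,
        AdjoinRoot.of (curvePoly F q r) X - algebraMap F _ t} := by
  set I := Ideal.span {AdjoinRoot.root (curvePoly F q r) - algebraMap F _ s,
        AdjoinRoot.of (curvePoly F q r) X - algebraMap F _ t}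
  have hx : AdjoinRoot.root (curvePoly F q r) - algebraMap F _ s ∈ I :=
    Ideal.subset_span (Or.inl rfl)
  have hy : AdjoinRoot.of (curvePoly F q r) X - algebraMap F _ t ∈ I :=
    Ideal.subset_span (Or.inr rfl)
  have key : ((Ideal.Quotient.mk I).comp (algebraMap F (CoordRing F q r))).comp
      (evalPoint s t h : CoordRing F q r →+* F) = Ideal.Quotient.mk I := by
    refine AdjoinRoot.ringHom_ext ?_ ?_
    · refine Polynomial.ringHom_ext (fun u => ?_) ?_
      · change Ideal.Quotient.mk I (algebraMap F _ (evalPoint s t h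
          (AdjoinRoot.of (curvePoly F q r) (C u)))) = _
        rw [evalPoint_of, eval_C]
        rfl
      · change Ideal.Quotient.mk I (algebraMap F _ (evalPoint s t h
          (AdjoinRoot.of (curvePoly F q r) X))) = _
        rw [evalPoint_of, eval_X]
        exact (Ideal.Quotient.eq.2 hy).symm
    · change Ideal.Quotient.mk I (algebraMap F _ (evalPoint s t h
          (AdjoinRoot.root (curvePoly F q r)))) = _
      rw [evalPoint_root]
      exact (Ideal.Quotient.eq.2 hx).symm
  rw [← Ideal.Quotient.eq_zero_iff_mem, ← key]
  change Ideal.Quotient.mk I (algebraMap F _ (evalPoint s t h α)) = 0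
  rw [hα, map_zero, map_zero]

theorem exists_place_liesOver (s t : F)
    (h : s ^ normExp q r = ∑ i ∈ Finset.range r, t ^ q ^ i) :
    ∃ v : Place F q r, v.LiesOver ![s, t, 1] := by
  obtain ⟨V, h1, h2⟩ := exists_valuationSubring_of_injective
    (algebraMap (CoordRing F q r) (FunField F q r)) (IsFractionRing.injective _ _)
    (RingHom.ker (evalPoint s t h)) (RingHom.ker_ne_top _)
  have hy : yFun F q r - algebraMap F _ t ∈ V.nonunits := by
    have := h2 (AdjoinRoot.of (curvePoly F q r) X - algebraMap F _ t) (by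
      rw [RingHom.mem_ker, map_sub, evalPoint_of, eval_X, AlgHom.commutes]
      exact sub_self t)
    rwa [map_sub] at this
  have hx : xFun F q r - algebraMap F _ s ∈ V.nonunits := by
    have := h2 (AdjoinRoot.root (curvePoly F q r) - algebraMap F _ s) (by
      rw [RingHom.mem_ker, map_sub, evalPoint_root, AlgHom.commutes]
      exact sub_self s)
    rwa [map_sub] at this
  refine ⟨⟨V, fun u => h1 (algebraMap F _ u), ?_⟩, (Place.liesOver_affine_iff _ s t).2 ⟨hx, hy⟩⟩
  rintro rfl
  have h3 := ((⊤ : ValuationSubring _).mem_nonunits_iff_or.1 hy).resolve_right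
    (fun h => h (ValuationSubring.mem_top _))
  have h4 : aeval (yFun F q r) (X - C t) = 0 := by simpa using h3
  rw [map_eq_zero_iff _ (aeval_yFun_injective F q r)] at h4
  exact X_sub_C_ne_zero t h4

/-- The difference between a function and its value is a combination of `x - s` and `y - t` with
coefficients regular at `v`. This holds at every place above the point, so no smoothness is needed.
-/
theorem Place.hasValue_evalPoint (v : Place F q r) (s t : F)
    (h : s ^ normExp q r = ∑ i ∈ Finset.range r, t ^ q ^ i) (hv : v.LiesOver ![s, t, 1])
    (α : CoordRing F q r) :
    v.HasValue (algebraMap _ (FunField F q r) α) (evalPoint s t h α) := by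
  rw [v.liesOver_affine_iff] at hv
  have hx : xFun F q r ∈ v.ring := by
    have := v.ring.add_mem _ _ (v.ring.nonunits_le hv.1) (v.constants_mem s)
    rwa [sub_add_cancel] at this
  have hy : yFun F q r ∈ v.ring := by
    have := v.ring.add_mem _ _ (v.ring.nonunits_le hv.2) (v.constants_mem t)
    rwa [sub_add_cancel] at this
  have hmem : ∀ β : CoordRing F q r, algebraMap _ (FunField F q r) β ∈ v.ring := fun β => by
    obtain ⟨a, ha⟩ := exists_coordinates F q r β
    rw [ha]
    exact sum_mem fun i _ => mul_mem (aeval_mem_valuationSubring v.ring v.constants_mem hy _)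
      (pow_mem hx i)
  have h1 : α - algebraMap F _ (evalPoint s t h α) ∈ RingHom.ker (evalPoint s t h) := by
    rw [RingHom.mem_ker, map_sub, AlgHom.commutes]
    exact sub_self _
  obtain ⟨β, γ, hβγ⟩ := Ideal.mem_span_pair.1 (mem_ideal_of_evalPoint_eq_zero s t h h1)
  have h2 := congrArg (algebraMap _ (FunField F q r)) hβγ
  rw [map_sub] at h2
  change _ - algebraMap F (FunField F q r) _ ∈ _
  rw [IsScalarTower.algebraMap_apply F (CoordRing F q r) (FunField F q r), ← h2, map_add, map_mul,
    map_mul, map_sub, map_sub]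
  have hm : ∀ z ∈ v.ring, ∀ w ∈ v.ring.nonunits, z * w ∈ v.ring.nonunits := fun z hz w hw => by
    rw [ValuationSubring.mem_nonunits_iff, map_mul] at *
    exact (mul_le_of_le_one_left' ((v.ring.valuation_le_one_iff _).2 hz)).trans_lt hw
  exact add_mem (hm _ (hmem β) _ hv.1) (hm _ (hmem γ) _ hv.2)

theorem Place.hasValue_unique (v : Place F q r) {f : FunField F q r} {s t : F}
    (hs : v.HasValue f s) (ht : v.HasValue f t) : s = t := by
  by_contra hst
  have h := sub_mem ht hs
  rw [sub_sub_sub_cancel_left, ← map_sub, ValuationSubring.mem_nonunits_iff,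
    valuation_algebraMap_eq_one v.ring v.constants_mem (sub_ne_zero.2 hst)] at h
  exact lt_irrefl _ h

/-- The place is the local ring of the plane curve at the origin. From `x ^ c = y * u(y)` with
`u(y)` a unit, its maximal ideal `(x, y)` is `(x)`, and a Noetherian local domain with principal
maximal ideal is a valuation ring. -/
theorem exists_place_origin_uniformizer :
    ∃ (v : Place F q r) (hx : xFun F q r ∈ v.ring.nonunits),
    yFun F q r ∈ v.ring.nonunits ∧
    IsLocalRing.maximalIdeal v.ring = Ideal.span {⟨xFun F q r, v.ring.nonunits_le hx⟩} := by
  have hq : 2 ≤ q := (Fact.out : IsPrimePow q).two_le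
  have h0 : (0 : F) ^ normExp q r = ∑ i ∈ Finset.range r, (0 : F) ^ q ^ i := by
    rw [zero_pow (normExp_pos q r).ne', Finset.sum_eq_zero]
    intro i _
    exact zero_pow (by positivity)
  let A := CoordRing F q r
  let K := FunField F q r
  let P : Ideal A := RingHom.ker (evalPoint (0 : F) 0 h0)
  have hP : P.IsPrime := RingHom.ker_isPrime _
  have hle : P.primeCompl ≤ nonZeroDivisors A := P.primeCompl_le_nonZeroDivisors
  let R := Localization.subalgebra.ofField K P.primeCompl hle
  have hloc : IsLocalization P.primeCompl R := Localization.subalgebra.isLocalization_ofField K _ hle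
  have hlocal : IsLocalRing R := IsLocalization.AtPrime.isLocalRing R P
  have hmonic : (curvePoly F q r).Monic := monic_X_pow_sub_C _ (normExp_pos q r).ne'
  have : Module.Finite F[X] A := hmonic.finite_adjoinRoot
  have hA : IsNoetherianRing A := IsNoetherianRing.of_finite F[X] A
  have hR : IsNoetherianRing R := IsLocalization.isNoetherianRing P.primeCompl R hA
  have hfrac : IsFractionRing R K := Localization.subalgebra.isFractionRing_ofField K _ hle
  obtain ⟨u, hu0, hu⟩ := tracePoly_eq_X_mul (F := F) (q := q) (r := r)
  have hyx : AdjoinRoot.root (curvePoly F q r) ^ normExp q r =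
      AdjoinRoot.of (curvePoly F q r) X * AdjoinRoot.of (curvePoly F q r) u := by
    rw [root_pow_normExp, hu, map_mul]
  let x : R := algebraMap A R (AdjoinRoot.root (curvePoly F q r))
  have hunit : IsUnit (algebraMap A R (AdjoinRoot.of (curvePoly F q r) u)) := by
    rw [IsLocalization.AtPrime.isUnit_to_map_iff R P]
    change ¬ _ = (0 : F)
    rw [evalPoint_of, ← coeff_zero_eq_eval_zero]
    exact hu0
  have hy : algebraMap A R (AdjoinRoot.of (curvePoly F q r) X) ∈ Ideal.span {x} := by
    rw [Ideal.mem_span_singleton, ← hunit.dvd_mul_right, ← map_mul, ← hyx, map_pow]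
    exact dvd_pow_self _ (normExp_pos q r).ne'
  have hmax : IsLocalRing.maximalIdeal R = Ideal.span {x} := by
    rw [← IsLocalization.AtPrime.map_eq_maximalIdeal P R]
    refine le_antisymm (Ideal.map_le_iff_le_comap.2 fun α hα => ?_) ?_
    · have h1 := mem_ideal_of_evalPoint_eq_zero 0 0 h0 hα
      refine (Ideal.span_le.2 ?_ : Ideal.span _ ≤ (Ideal.span {x}).comap (algebraMap A R)) h1
      rintro _ (rfl | rfl)
      · rw [map_zero, sub_zero]
        exact Ideal.mem_span_singleton_self x
      · rw [map_zero, sub_zero]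
        exact hy
    · rw [Ideal.span_singleton_le_iff_mem]
      exact Ideal.mem_map_of_mem _ (evalPoint_root 0 0 h0)
  have hprin : (IsLocalRing.maximalIdeal R).IsPrincipal := ⟨x, hmax⟩
  have hval : ValuationRing R :=
    ((tfae_of_isNoetherianRing_of_isLocalRing_of_isDomain R).out 4 1).1 hprin
  let V : ValuationSubring K := ⟨R.toSubring, fun f => by
    rcases ValuationRing.isInteger_or_isInteger R f with ⟨a, ha⟩ | ⟨a, ha⟩
    · exact Or.inl (ha ▸ a.2)
    · exact Or.inr (ha ▸ a.2)⟩
  have hmaxV : IsLocalRing.maximalIdeal V = Ideal.span {(⟨x.1, x.2⟩ : V)} :=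
    hmax
  have hxV : xFun F q r ∈ V.nonunits := ValuationSubring.mem_nonunits_iff_exists_mem_maximalIdeal.2
    ⟨x.2, by rw [hmaxV]; exact Ideal.mem_span_singleton_self _⟩
  have hV : ∀ t : F, algebraMap F K t ∈ V := fun t => R.algebraMap_mem (algebraMap F A t)
  have hyV : yFun F q r ∈ V.nonunits := ValuationSubring.mem_nonunits_iff_exists_mem_maximalIdeal.2
    ⟨(algebraMap A R (AdjoinRoot.of (curvePoly F q r) X)).2, by rw [hmaxV]; exact hy⟩
  refine ⟨⟨V, hV, fun h => ?_⟩, hxV, hyV, hmaxV⟩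
  refine (V.mem_nonunits_iff_or.1 hxV).elim xFun_ne_zero fun h1 => h1 ?_
  rw [h]
  exact ValuationSubring.mem_top _

end Points

/-! ### Injectivity of evaluation, the dimension of the code, and the isomorphism. -/

section Code

theorem exists_charP {F : Type*} [Field F] {q : ℕ} [hq : Fact (IsPrimePow q)] (h : (q : F) = 0) :
    ∃ p k : ℕ, p.Prime ∧ CharP F p ∧ q = p ^ k := by
  obtain ⟨p, k, hp, hk, rfl⟩ := (isPrimePow_nat_iff q).1 hq.out
  refine ⟨p, k, hp, (CharP.charP_iff_prime_eq_zero hp).2 ?_, rfl⟩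
  rw [Nat.cast_pow] at h
  exact (pow_eq_zero_iff hk.ne').1 h

variable {F : Type*} [Field F] {q r : ℕ} [Fact (IsPrimePow q)] [Fact (2 ≤ r)]

variable (F q r) in
/-- The trace map of the degree `r` extension, as an additive map. -/
noncomputable def traceHom (h : (q : F) = 0) : F →+ F where
  toFun t := ∑ i ∈ Finset.range r, t ^ q ^ i
  map_zero' := Finset.sum_eq_zero fun i _ =>
    zero_pow (pow_ne_zero _ (Fact.out : IsPrimePow q).pos.ne')
  map_add' s t := by
    obtain ⟨p, k, hp, hc, rfl⟩ := exists_charP (F := F) (q := q) h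
    have := Fact.mk hp
    rw [← Finset.sum_add_distrib]
    refine Finset.sum_congr rfl fun i _ => ?_
    rw [← pow_mul]
    exact add_pow_char_pow s t _ _

/-- The `q`-th power map permutes the summands cyclically, as `t ^ q ^ r = t`. -/
theorem traceHom_pow [Finite F] (hF : Nat.card F = q ^ r) (h : (q : F) = 0) (t : F) :
    traceHom F q r h t ^ q = traceHom F q r h t := by
  have ht : t ^ q ^ r = t := by
    have := Fintype.ofFinite F
    rw [← hF, Nat.card_eq_fintype_card, FiniteField.pow_card]
  change (∑ i ∈ Finset.range r, t ^ q ^ i) ^ q = ∑ i ∈ Finset.range r, t ^ q ^ i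
  have h1 : (∑ i ∈ Finset.range r, t ^ q ^ i) ^ q = ∑ i ∈ Finset.range r, t ^ q ^ (i + 1) := by
    obtain ⟨p, k, hp, hc, rfl⟩ := exists_charP (F := F) (q := q) h
    have := Fact.mk hp
    rw [sum_pow_char_pow]
    refine Finset.sum_congr rfl fun i _ => ?_
    rw [← pow_mul, ← pow_succ]
  have h2 := Finset.sum_range_succ (fun i => t ^ q ^ i) r
  rw [Finset.sum_range_succ', ht, pow_zero, pow_one] at h2
  rw [h1, add_right_cancel h2]

/-- Counting roots bounds the kernel by `q ^ (r - 1)` and the solutions of `z ^ q = z`, which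
include the image, by `q`. Kernel and image sizes multiply to `q ^ r`, so both bounds are attained.
-/
theorem ker_range_traceHom [Finite F] (hF : Nat.card F = q ^ r) (h : (q : F) = 0) :
    q ^ (r - 1) ≤ Nat.card (traceHom F q r h).ker ∧
      ∀ z : F, z ^ q = z → z ∈ (traceHom F q r h).range := by
  have hq : 2 ≤ q := (Fact.out : IsPrimePow q).two_le
  have hr : 2 ≤ r := Fact.out
  set T := traceHom F q r h
  have hker : Nat.card T.ker ≤ q ^ (r - 1) := by
    have hT : tracePoly F q r ≠ 0 := (squarefree_tracePoly q r h (by omega)).ne_zero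
    by_contra! hlt
    refine hT (eq_zero_of_natDegree_lt_card_of_eval_eq_zero' _ (T.ker : Set F).toFinite.toFinset
      (fun t ht => ?_) ?_)
    · have : T t = 0 := by simpa using ht
      rw [← this]
      simp [tracePoly, eval_finsetSum, T, traceHom]
    · rw [natDegree_tracePoly F q r hq (by omega), ← Set.ncard_eq_toFinset_card]
      exact hlt
  let S : Set F := {z | z ^ q = z}
  have hS : S.ncard ≤ q := by
    by_contra! hlt
    refine FiniteField.X_pow_card_sub_X_ne_zero F (p := q) (by omega)
      (eq_zero_of_natDegree_lt_card_of_eval_eq_zero' _ S.toFinite.toFinset (fun t ht => ?_) ?_)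
    · have : t ^ q = t := S.toFinite.mem_toFinset.1 ht
      simp [this]
    · rw [FiniteField.X_pow_card_sub_X_natDegree_eq F (by omega), ← Set.ncard_eq_toFinset_card]
      exact hlt
  have hsub : (T.range : Set F) ⊆ S := by
    rintro _ ⟨t, rfl⟩
    exact traceHom_pow hF h t
  have hcard : Nat.card T.ker * (T.range : Set F).ncard = q ^ (r - 1) * q := by
    rw [← pow_succ, Nat.sub_add_cancel (by omega), ← hF, ← T.ker.card_mul_index,
      AddSubgroup.index_ker]
    rfl
  have hle := Set.ncard_le_ncard hsub
  have hqpos : 0 < q ^ (r - 1) := by positivity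
  constructor
  · by_contra! hlt
    nlinarith [Nat.mul_le_mul_left (Nat.card T.ker) (hle.trans hS)]
  · have : S ⊆ (T.range : Set F) := by
      refine (Set.eq_of_subset_of_ncard_le hsub ?_).ge
      by_contra! hlt
      nlinarith [Nat.mul_le_mul_right (T.range : Set F).ncard hker]
    exact fun z hz => this hz

/-- Since `s ^ ((q - 1) c) = 1`, the norm `s ^ c` is fixed by the `q`-th power map, hence is a
trace. The fibre is then a coset of the kernel, with at least `q ^ (r - 1) ≥ q` points. -/
theorem eq_zero_of_eval_fibre [Finite F] (hF : Nat.card F = q ^ r) {s : F} (hs : s ≠ 0) {g : F[X]}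
    (hg : g.natDegree < q)
    (h : ∀ t : F, s ^ normExp q r = ∑ i ∈ Finset.range r, t ^ q ^ i → g.eval t = 0) : g = 0 := by
  have hq0 := natCast_eq_zero F q r hF
  obtain ⟨h1, h2⟩ := ker_range_traceHom (F := F) (q := q) (r := r) hF hq0
  have hz : (s ^ normExp q r) ^ q = s ^ normExp q r := by
    have hc := normExp_mul q r
    have : 2 ≤ q := (Fact.out : IsPrimePow q).two_le
    have h3 : s ^ ((q - 1) * normExp q r) = 1 := by
      have := Fintype.ofFinite F
      rw [hc, ← hF, Nat.card_eq_fintype_card]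
      exact FiniteField.pow_card_sub_one_eq_one s hs
    obtain ⟨n, rfl⟩ := Nat.exists_eq_add_of_le' (show 1 ≤ q by omega)
    rw [Nat.add_sub_cancel, mul_comm] at h3
    rw [pow_succ, ← pow_mul, h3, one_mul]
  obtain ⟨t, ht⟩ := h2 _ hz
  have := Fintype.ofFinite (traceHom F q r hq0).ker
  refine eq_zero_of_natDegree_lt_card_of_eval_eq_zero g
    (f := fun k : (traceHom F q r hq0).ker => t + k) (fun k l hkl => Subtype.ext (add_left_cancel hkl))
    (fun k => h _ ?_) ?_
  · change _ = traceHom F q r hq0 (t + k)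
    rw [map_add, ht, k.2, add_zero]
  · rw [← Nat.card_eq_fintype_card]
    refine hg.trans_le ((Nat.le_self_pow ?_ q).trans h1)
    have : 2 ≤ r := Fact.out
    omega

/-- The outer variable is `x`, the inner one `y`. The two degree bounds serve the two rounds of root
counting: in `y` on a line `x = s`, then in `x`. -/
theorem exists_polynomial_of_mem_forms {d : ℕ} {f : FunField F q r} (hf : f ∈ forms F q r d) :
    ∃ p : F[X][X], p.natDegree ≤ d ∧ (∀ s : F, (p.eval (C s)).natDegree ≤ d) ∧
      f = algebraMap _ _ (AdjoinRoot.mk (curvePoly F q r) p) := by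
  induction hf using Submodule.span_induction with
  | zero => exact ⟨0, by simp⟩
  | add f f' _ _ h1 h2 =>
    obtain ⟨p, hp, hs, rfl⟩ := h1
    obtain ⟨p', hp', hs', rfl⟩ := h2
    exact ⟨p + p', natDegree_add_le_of_degree_le hp hp', fun s => by
      rw [eval_add]; exact natDegree_add_le_of_degree_le (hs s) (hs' s), by rw [map_add, map_add]⟩
  | smul t f _ h1 =>
    obtain ⟨p, hp, hs, rfl⟩ := h1
    refine ⟨C (C t) * p, (natDegree_C_mul_le _ _).trans hp, fun s => ?_, ?_⟩
    · rw [eval_mul, eval_C]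
      exact (natDegree_C_mul_le _ _).trans (hs s)
    · rw [map_mul, map_mul, Algebra.smul_def]
      rfl
  | mem f h =>
    obtain ⟨i, j, hij, rfl⟩ := h
    refine ⟨X ^ i * C (X ^ j), ?_, fun s => ?_, ?_⟩
    · refine (natDegree_mul_C_le _ _).trans ?_
      rw [natDegree_X_pow]
      omega
    · rw [eval_mul, eval_pow, eval_X, eval_C, ← C_pow]
      refine (natDegree_C_mul_le _ _).trans ?_
      rw [natDegree_X_pow]
      omega
    · rw [map_mul, map_mul, C_pow, map_pow, map_pow, map_pow, map_pow]
      rfl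

variable (F q r) in
/-- Evaluation of regular functions at the rational points of the curve other than `P_∞`
and `P₀`. -/
noncomputable def evalMap : CoordRing F q r →ₗ[F] (EvalPoint F q r → F) :=
  LinearMap.pi fun P => (evalPoint P.1.1 P.1.2 P.2.1).toLinearMap

theorem eq_zero_of_evalMap_eq_zero [Finite F] (hF : Nat.card F = q ^ r) {d : ℕ} (hd : d < q)
    {α : CoordRing F q r} (hα : algebraMap _ (FunField F q r) α ∈ forms F q r d)
    (h : evalMap F q r α = 0) : α = 0 := by
  obtain ⟨p, hp, hps, hαp⟩ := exists_polynomial_of_mem_forms hα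
  obtain rfl := IsFractionRing.injective _ _ hαp
  have h0 : ∀ s : F, s ≠ 0 → p.eval (C s) = 0 := fun s hs => by
    refine eq_zero_of_eval_fibre hF hs ((hps s).trans_lt hd) fun t ht => ?_
    have h1 := congrFun h ⟨(s, t), ht, fun e => hs (congrArg Prod.fst e)⟩
    change evalPoint s t ht (AdjoinRoot.mk (curvePoly F q r) p) = 0 at h1
    rw [← h1]
    change _ = AdjoinRoot.lift (evalRingHom t) s (eval₂_curvePoly_evalRingHom ht) _
    rw [AdjoinRoot.lift_mk, eval₂_evalRingHom]
  suffices p = 0 by rw [this, map_zero]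
  have := Fintype.ofFinite Fˣ
  refine eq_zero_of_natDegree_lt_card_of_eval_eq_zero p (f := fun u : Fˣ => C (u : F))
    (fun u v huv => Units.ext (C_injective huv)) (fun u => h0 u u.ne_zero) ?_
  rw [← Nat.card_eq_fintype_card, Nat.card_units, hF]
  have : q ^ 2 ≤ q ^ r := Nat.pow_le_pow_right (by omega) Fact.out
  have : 2 * q ≤ q ^ 2 := by nlinarith [(Fact.out : IsPrimePow q).two_le]
  omega

/-- Sections are forms, so they come from the coordinate ring, where values at places become the
linear map `evalMap`. Existence of a place above each point and uniqueness of values identify the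
code with its image. -/
theorem finrank_code [Finite F] (hF : Nat.card F = q ^ r) {d : ℕ} (hd : d < q) (a b : ℕ) :
    Module.finrank F (code F q r d a b) = Module.finrank F (sectionsNorm F q r d a b) := by
  have hle : sectionsNorm F q r d a b ≤ forms F q r d :=
    (sectionsNorm_eq_sectionsCurve F q r hF hd a b).le.trans inf_le_left
  let φ : CoordRing F q r →ₗ[F] FunField F q r := (IsScalarTower.toAlgHom F _ _).toLinearMap
  have hφ : Function.Injective φ := IsFractionRing.injective (CoordRing F q r) (FunField F q r)
  let M := (sectionsNorm F q r d a b).comap φ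
  have h1 : sectionsNorm F q r d a b = M.map φ := by
    refine le_antisymm (fun f hf => ?_) (Submodule.map_comap_le _ _)
    obtain ⟨p, -, -, rfl⟩ := exists_polynomial_of_mem_forms (hle hf)
    exact ⟨_, hf, rfl⟩
  have h2 : code F q r d a b = LinearMap.range ((evalMap F q r).domRestrict M) := by
    ext w
    constructor
    · rintro ⟨f, hf, hw⟩
      rw [h1] at hf
      obtain ⟨α, hα, rfl⟩ := hf
      refine ⟨⟨α, hα⟩, funext fun P => ?_⟩
      obtain ⟨v, hv⟩ := exists_place_liesOver P.1.1 P.1.2 P.2.1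
      exact v.hasValue_unique (v.hasValue_evalPoint _ _ P.2.1 hv α) (hw P v hv)
    · rintro ⟨⟨α, hα⟩, rfl⟩
      exact ⟨φ α, hα, fun P v hv => v.hasValue_evalPoint _ _ P.2.1 hv α⟩
  rw [h2, LinearMap.finrank_range_of_inj, h1]
  · exact (Submodule.equivMapOfInjective φ hφ M).finrank_eq
  · refine (injective_iff_map_eq_zero _).2 fun α hα => Subtype.ext ?_
    exact eq_zero_of_evalMap_eq_zero hF hd (hle α.2) hα

theorem exists_eq_mul_yFun_of_mem_sectionsCurve {d a b : ℕ} (hdb : d + 1 < b) (hb : b ≤ normExp q r)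
    {f : FunField F q r} (hf : f ∈ sectionsCurve F q r (d + 1) a b) :
    ∃ g ∈ forms F q r d, f = yFun F q r * g := by
  obtain ⟨h, hh, g, hg, rfl⟩ := exists_eq_aeval_add_mul hf.1
  refine ⟨g, hg, ?_⟩
  obtain ⟨v, hx, hy, hm⟩ := exists_place_origin_uniformizer (F := F) (q := q) (r := r)
  have hv : v.LiesOver ![0, 0, 1] := by
    rw [v.liesOver_affine_iff, map_zero, sub_zero, sub_zero]
    exact ⟨hx, hy⟩
  have hs := v.stalkOne_eq_span hv (i := 2) rfl
  obtain ⟨t, ht, e⟩ := (v.mem_vanishing_iff hs).1 ((hf.2 v).2.2 hv)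
  obtain ⟨w, hw, hyw⟩ := exists_yFun_eq v.ring v.constants_mem hy
  have hgv := v.forms_le_stalkOne_pow hg
  rw [← v.vanishing_zero, v.mem_vanishing_iff hs] at hgv
  obtain ⟨u, -, hu⟩ := hgv
  change _ * (1 : FunField F q r) ^ _ = _ at e hu
  rw [one_pow, mul_one] at e hu
  have hxm : (⟨_, v.ring.nonunits_le hx⟩ : v.ring) ∈ IsLocalRing.maximalIdeal v.ring := by
    rw [hm]
    exact Ideal.mem_span_singleton_self _
  have h0 : h = 0 := by
    -- `h(x)` is the section minus `y g = x ^ c * (w * u)`; both lie in the `b`-th power of the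
    -- maximal ideal because `b ≤ c`.
    refine aeval_eq_zero_of_mem_pow v hx hm (hh.trans_lt hdb)
      (t := t - ⟨_, v.ring.nonunits_le hx⟩ ^ normExp q r * (⟨w, hw⟩ * u)) (sub_mem ht ?_) ?_
    · exact Ideal.mul_mem_right _ _ (Ideal.pow_le_pow_right hb (Ideal.pow_mem_pow hxm _))
    · change _ = (t : FunField F q r) - xFun F q r ^ normExp q r * (w * u)
      rw [e, hu, ← mul_assoc, ← hyw, add_sub_cancel_right]
  rw [h0, map_zero, zero_add]

/-- Division by `y`, as an isomorphism of spaces of sections. -/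
noncomputable def divYEquiv {d a b : ℕ} (hdb : d + 1 < b) (hb : b ≤ normExp q r) :
    sectionsCurve F q r (d + 1) a b ≃ₗ[F] sectionsCurve F q r d a 0 where
  toFun f := ⟨f / yFun F q r, by
    obtain ⟨g, hg, h⟩ := exists_eq_mul_yFun_of_mem_sectionsCurve hdb hb f.2
    rw [h, mul_div_cancel_left₀ _ (yFun_ne_zero F q r)]
    exact div_yFun_mem_sectionsCurve hg (h ▸ f.2)⟩
  invFun g := ⟨yFun F q r * g, mul_yFun_mem_sectionsCurve hb g.2⟩
  map_add' f g := Subtype.ext (add_div _ _ _)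
  map_smul' t f := Subtype.ext (smul_div_assoc t (f : FunField F q r) (yFun F q r))
  left_inv f := Subtype.ext (mul_div_cancel₀ _ (yFun_ne_zero F q r))
  right_inv g := Subtype.ext (mul_div_cancel_left₀ _ (yFun_ne_zero F q r))

end Code

end NormTrace

theorem mainTheorem12 {F : Type*} [Field F] [Finite F] (q r : ℕ) [Fact (IsPrimePow q)]
    [Fact (2 ≤ r)] (hF : Nat.card F = q ^ r) (d a b : ℕ) (hd : 0 < d) (hdq : d < q)
    (ha : a ≤ NormTrace.normExp q r - 1) (hb : b ≤ NormTrace.normExp q r - 1) (hbd : d < b) :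
    Module.finrank F (NormTrace.code F q r d a b) =
        Module.finrank F (NormTrace.sectionsCurve F q r (d - 1) a 0) ∧
      NormTrace.sectionsNorm F q r d a b = NormTrace.sectionsCurve F q r d a b ∧
      NormTrace.sectionsNorm F q r (d - 1) a 0 = NormTrace.sectionsCurve F q r (d - 1) a 0 ∧
      ∃ e : NormTrace.sectionsCurve F q r d a b ≃ₗ[F] NormTrace.sectionsCurve F q r (d - 1) a 0,
        (∀ f, (e f : NormTrace.FunField F q r) = f / NormTrace.yFun F q r) ∧
          ∀ g, (e.symm g : NormTrace.FunField F q r) = NormTrace.yFun F q r * g := by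
  obtain ⟨d, rfl⟩ := Nat.exists_eq_add_of_le' hd
  rw [Nat.add_sub_cancel]
  have hS := NormTrace.sectionsNorm_eq_sectionsCurve F q r hF hdq a b
  let e := NormTrace.divYEquiv (F := F) (q := q) (r := r) (a := a) hbd (hb.trans (Nat.sub_le _ _))
  refine ⟨?_, hS, NormTrace.sectionsNorm_eq_sectionsCurve F q r hF (by omega) a 0, e,
    fun _ => rfl, fun _ => rfl⟩
  rw [NormTrace.finrank_code hF hdq, hS, e.finrank_eq]
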